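/- Let $G=(V,E)$ be a finite simple graph with $n=|V|$ and $m=|E|$, and let $w\in\mathbb R_{+}^{E}$ be a nonnegative weight function. For $r\in V$, an $r$-acyclic orientation of $G$ is an orientation of the edges such that the resulting digraph is acyclic and $r$ is its unique vertex of indegree $0$. For such an orientation $OE$, let $k_d(G,OE,w,r)$ be the maximum of $\sum_{i=1}^t\lambda_i$ over all packings of $r$-arborescences, i.e. families $(\lambda_1,A_1),\dots,(\lambda_t,A_t)$ of positive reals $\lambda_i$ and spanning $r$-arborescences $A_i$ of $(V,OE)$ with $\sum_{i:\,a\in A_i}\lambda_i\le w(a)$ for every arc $a$ (an arc has the weight of its edge). Put $k(G,w,r)=\max_{OE}k_d(G,OE,w,r)$, over all $r$-acyclic orientations $OE$ of $G$, and $k(G,w)=\max_{r\in V}k(G,w,r)$. The problem rBRP asks, given $(G,w,r)$, for $k(G,w,r)$, an $r$-acyclic orientation attaining it, and a packing of $r$-arborescences of that orientation of value $k(G,w,r)$; BRP asks, given $(G,w)$, for $k(G,w)$ together with a root $r$, an $r$-acyclic orientation and a packing attaining it. A graph is outerplanar if it has a planar drawing with all vertices on the boundary of the outer face. An outer circuit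 of a simple 2-connected outerplanar graph (which has at least three vertices) is the cycle that bounds the outer face in such a drawing; it passes through all vertices, and the chords of $G$ are the edges that do not lie on it, so that their number is $k=m-n$. Running times are numbers of steps of a real RAM: a machine with registers and arrays of natural and of real numbers, in which every memory access, every addition, subtraction or comparison (of two natural or of two real numbers) and every assignment takes one step. $G$ is given by $n$, $m$ and a list of its edges with their weights. Theorem. On simple 2-connected outerplanar graphs: (1) There is an algorithm that, given $(G,w,r)$, computes in $O((k+1)m)$ steps, where $k$ is the number of chords of $G$, the value $k(G,w,r)$ and an $r$-acyclic orientation $OE$ of $G$ with $k_d(G,OE,w,r)=k(G,w,r)$ whose minimum weighted indegree $\min_{v\in V\setminus\{r\}}w(\delta^-_{OE}(v))$ equals $k(G,w,r)$. (2) rBRP can be solved in polynomial time. (3) BRP can be solved in polynomial time. -/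

import Mathlib

namespace Broadcast

/-! ### Rooted acyclic orientations, arborescences and packings -/

section Packing

variable {V : Type*}

/-- `D` is an orientation of `G`: each edge of `G` gets exactly one of its two directions. -/
structure IsOrientation (G : SimpleGraph V) (D : Digraph V) : Prop where
  adj_iff : ∀ u v, G.Adj u v ↔ D.Adj u v ∨ D.Adj v u
  asymm : ∀ u v, D.Adj u v → ¬ D.Adj v u

/-- An `r`-acyclic orientation of `G`: an orientation without directed cycles in which `r` is the
unique vertex of indegree `0`. -/
structure IsRootedAcyclic (G : SimpleGraph V) (r : V) (D : Digraph V) : Prop where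
  orientation : IsOrientation G D
  acyclic : ∀ v, ¬ Relation.TransGen D.Adj v v
  source_iff : ∀ v, (∀ u, ¬ D.Adj u v) ↔ v = r

/-- A (spanning) `r`-arborescence `A` of the digraph `D`. -/
structure IsArborescence (D : Digraph V) (r : V) (A : Digraph V) : Prop where
  le : ∀ u v, A.Adj u v → D.Adj u v
  root : ∀ u, ¬ A.Adj u r
  parent : ∀ v, v ≠ r → ∃! u, A.Adj u v
  reachable : ∀ v, Relation.ReflTransGen A.Adj r v

open Classical in
/-- Pairs `(lam 0, A 0), …, (lam (t-1), A (t-1))` of positive reals and `r`-arborescences of `D`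
such that the total weight put on each arc is at most the weight of the underlying edge. -/
structure IsPacking (D : Digraph V) (w : Sym2 V → ℝ) (r : V) {t : ℕ}
    (lam : Fin t → ℝ) (A : Fin t → Digraph V) : Prop where
  pos : ∀ j, 0 < lam j
  arborescence : ∀ j, IsArborescence D r (A j)
  capacity : ∀ u v, D.Adj u v → (∑ j, if (A j).Adj u v then lam j else 0) ≤ w s(u, v)

/-- The values of the packings of `r`-arborescences of `D`. -/
def packingValues (D : Digraph V) (w : Sym2 V → ℝ) (r : V) : Set ℝ :=
  {x | ∃ (t : ℕ) (lam : Fin t → ℝ) (A : Fin t → Digraph V),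
    IsPacking D w r lam A ∧ x = ∑ j, lam j}

/-- `k_d(G, OE, w, r)`, the maximum value of a packing of `r`-arborescences of `D`. -/
noncomputable def kd (D : Digraph V) (w : Sym2 V → ℝ) (r : V) : ℝ :=
  sSup (packingValues D w r)

/-- The values `k_d(G, OE, w, r)` over all `r`-acyclic orientations `OE` of `G`. -/
def rootedValues (G : SimpleGraph V) (w : Sym2 V → ℝ) (r : V) : Set ℝ :=
  {x | ∃ D : Digraph V, IsRootedAcyclic G r D ∧ x = kd D w r}

/-- `k(G, w, r)`. -/
noncomputable def kRooted (G : SimpleGraph V) (w : Sym2 V → ℝ) (r : V) : ℝ :=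
  sSup (rootedValues G w r)

/-- The values `k(G, w, r)` over all vertices `r`; the maximum of this set is `k(G, w)`. -/
def broadcastValues (G : SimpleGraph V) (w : Sym2 V → ℝ) : Set ℝ :=
  {x | ∃ r : V, x = kRooted G w r}

open Classical in
/-- The weight of the set of arcs of `D` that enter `v`. -/
noncomputable def inWeight [Fintype V] (D : Digraph V) (w : Sym2 V → ℝ) (v : V) : ℝ :=
  ∑ u, if D.Adj u v then w s(u, v) else 0

end Packing

/-! ### Simple 2-connected outerplanar graphs -/

section Outerplanar

variable {V : Type*}

/-- 2-connected: at least three vertices, connected, and without cut vertex. -/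
structure IsTwoConnected (G : SimpleGraph V) : Prop where
  three_le : 3 ≤ Nat.card V
  connected : G.Connected
  no_cut : ∀ v, (G.induce {v}ᶜ).Connected

/-- A planar drawing of `G`: distinct points for distinct vertices, a simple arc between the
endpoints for each edge; arcs pass through no other vertex and meet only in common endpoints. -/
structure PlanarDrawing (G : SimpleGraph V) where
  point : V → ℝ × ℝ
  arc : Sym2 V → Set (ℝ × ℝ)
  point_injective : Function.Injective point
  arc_spec : ∀ u v, G.Adj u v → ∃ γ : unitInterval → ℝ × ℝ, Continuous γ ∧
    Function.Injective γ ∧ γ 0 = point u ∧ γ 1 = point v ∧ Set.range γ = arc s(u, v)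
  vertex_on_arc : ∀ e ∈ G.edgeSet, ∀ x, point x ∈ arc e → x ∈ e
  arc_inter : ∀ e ∈ G.edgeSet, ∀ f ∈ G.edgeSet, e ≠ f → arc e ∩ arc f ⊆ Set.range point

/-- The set of points of the plane that are covered by the drawing. -/
def PlanarDrawing.carrier {G : SimpleGraph V} (Γ : PlanarDrawing G) : Set (ℝ × ℝ) :=
  Set.range Γ.point ∪ ⋃ e ∈ G.edgeSet, Γ.arc e

/-- The outer face: the unbounded connected component of the complement of the drawing. -/
def PlanarDrawing.outerFace {G : SimpleGraph V} (Γ : PlanarDrawing G) : Set (ℝ × ℝ) :=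
  {p | p ∈ Γ.carrierᶜ ∧ ¬ Bornology.IsBounded (connectedComponentIn Γ.carrierᶜ p)}

/-- All vertices lie on the (boundary of the) outer face. -/
def PlanarDrawing.IsOuter {G : SimpleGraph V} (Γ : PlanarDrawing G) : Prop :=
  ∀ v, Γ.point v ∈ frontier Γ.outerFace

/-- `G` has a planar drawing for which all vertices belong to the outer face. -/
def IsOuterplanar (G : SimpleGraph V) : Prop :=
  ∃ Γ : PlanarDrawing G, Γ.IsOuter

/-- `c` is an outer circuit of `G`: a cycle of `G` that bounds the outer face of some drawing with
all vertices on the outer face. -/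
def IsOuterCircuit {G : SimpleGraph V} {u : V} (c : G.Walk u u) : Prop :=
  c.IsCycle ∧ ∃ Γ : PlanarDrawing G, Γ.IsOuter ∧
    frontier Γ.outerFace = ⋃ e ∈ {e | e ∈ c.edges}, Γ.arc e

/-- The number of chords of `G` with respect to the circuit `c`: edges of `G` not on `c`. -/
noncomputable def numChords {G : SimpleGraph V} {u : V} (c : G.Walk u u) : ℕ :=
  (G.edgeSet \ {e | e ∈ c.edges}).ncard

end Outerplanar

/-! ### The machine model

A real RAM: structured programs over natural-number and real registers and arrays (array names
are fixed in the program, indices are computed). Natural numbers can be added, subtracted (with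
truncation at `0`) and compared; real numbers can be added, subtracted and compared, and the only
real constant is `0`. Each operation, memory access, assignment and test takes one step. -/

/-- The memory of the machine. -/
structure Store where
  natVar : ℕ → ℕ
  natArr : ℕ → ℕ → ℕ
  realVar : ℕ → ℝ
  realArr : ℕ → ℕ → ℝ

/-- Natural-number expressions. -/
inductive NExp where
  | lit (c : ℕ)
  | var (x : ℕ)
  | get (a : ℕ) (i : NExp)
  | plus (e f : NExp)
  | minus (e f : NExp)

/-- Real expressions. -/
inductive RExp where
  | zero
  | var (x : ℕ)
  | get (a : ℕ) (i : NExp)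
  | plus (e f : RExp)
  | minus (e f : RExp)

/-- Tests. -/
inductive BExp where
  | natLe (e f : NExp)
  | realLe (e f : RExp)
  | neg (b : BExp)
  | both (b c : BExp)

/-- Value of a natural-number expression. -/
def NExp.eval (s : Store) : NExp → ℕ
  | .lit c => c
  | .var x => s.natVar x
  | .get a i => s.natArr a (i.eval s)
  | .plus e f => e.eval s + f.eval s
  | .minus e f => e.eval s - f.eval s

/-- Number of steps for evaluating a natural-number expression. -/
def NExp.cost : NExp → ℕ
  | .lit _ => 1
  | .var _ => 1
  | .get _ i => i.cost + 1
  | .plus e f => e.cost + f.cost + 1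
  | .minus e f => e.cost + f.cost + 1

/-- Value of a real expression. -/
noncomputable def RExp.eval (s : Store) : RExp → ℝ
  | .zero => 0
  | .var x => s.realVar x
  | .get a i => s.realArr a (i.eval s)
  | .plus e f => e.eval s + f.eval s
  | .minus e f => e.eval s - f.eval s

/-- Number of steps for evaluating a real expression. -/
def RExp.cost : RExp → ℕ
  | .zero => 1
  | .var _ => 1
  | .get _ i => i.cost + 1
  | .plus e f => e.cost + f.cost + 1
  | .minus e f => e.cost + f.cost + 1

/-- Truth of a test. -/
def BExp.Holds (s : Store) : BExp → Prop
  | .natLe e f => e.eval s ≤ f.eval s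
  | .realLe e f => e.eval s ≤ f.eval s
  | .neg b => ¬ b.Holds s
  | .both b c => b.Holds s ∧ c.Holds s

/-- Number of steps for evaluating a test. -/
def BExp.cost : BExp → ℕ
  | .natLe e f => e.cost + f.cost + 1
  | .realLe e f => e.cost + f.cost + 1
  | .neg b => b.cost + 1
  | .both b c => b.cost + c.cost + 1

/-- Programs. -/
inductive Prog where
  | skip
  | setNat (x : ℕ) (e : NExp)
  | putNat (a : ℕ) (i e : NExp)
  | setReal (x : ℕ) (e : RExp)
  | putReal (a : ℕ) (i : NExp) (e : RExp)
  | seq (p q : Prog)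
  | branch (b : BExp) (p q : Prog)
  | loop (b : BExp) (p : Prog)

/-- `Exec p s T s'`: the program `p`, started on the memory `s`, halts after exactly `T` steps on
the memory `s'`. (`loop b p` repeats `p` as long as `b` holds.) -/
inductive Exec : Prog → Store → ℕ → Store → Prop
  | skip (s : Store) : Exec .skip s 1 s
  | setNat (s : Store) (x : ℕ) (e : NExp) :
      Exec (.setNat x e) s (e.cost + 1)
        { s with natVar := Function.update s.natVar x (e.eval s) }
  | putNat (s : Store) (a : ℕ) (i e : NExp) :
      Exec (.putNat a i e) s (i.cost + e.cost + 1)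
        { s with natArr :=
            Function.update s.natArr a (Function.update (s.natArr a) (i.eval s) (e.eval s)) }
  | setReal (s : Store) (x : ℕ) (e : RExp) :
      Exec (.setReal x e) s (e.cost + 1)
        { s with realVar := Function.update s.realVar x (e.eval s) }
  | putReal (s : Store) (a : ℕ) (i : NExp) (e : RExp) :
      Exec (.putReal a i e) s (i.cost + e.cost + 1)
        { s with realArr :=
            Function.update s.realArr a (Function.update (s.realArr a) (i.eval s) (e.eval s)) }
  | seq {p q : Prog} {s s' s'' : Store} {T T' : ℕ} :
      Exec p s T s' → Exec q s' T' s'' → Exec (.seq p q) s (T + T') s''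
  | branch_true {b : BExp} {p q : Prog} {s s' : Store} {T : ℕ} :
      b.Holds s → Exec p s T s' → Exec (.branch b p q) s (b.cost + 1 + T) s'
  | branch_false {b : BExp} {p q : Prog} {s s' : Store} {T : ℕ} :
      ¬ b.Holds s → Exec q s T s' → Exec (.branch b p q) s (b.cost + 1 + T) s'
  | loop_true {b : BExp} {p : Prog} {s s' s'' : Store} {T T' : ℕ} :
      b.Holds s → Exec p s T s' → Exec (.loop b p) s' T' s'' →
        Exec (.loop b p) s (b.cost + 1 + T + T') s''
  | loop_false {b : BExp} {p : Prog} {s : Store} :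
      ¬ b.Holds s → Exec (.loop b p) s (b.cost + 1) s

/-! ### Input and output -/

section InputOutput

variable {n m : ℕ} {G : SimpleGraph (Fin n)}

/-- A listing of the edges of `G`, each exactly once, as pairs of endpoints in any order. -/
structure EdgeList (G : SimpleGraph (Fin n)) (m : ℕ) where
  src : Fin m → Fin n
  dst : Fin m → Fin n
  injective : Function.Injective fun i => s(src i, dst i)
  range_eq : Set.range (fun i => s(src i, dst i)) = G.edgeSet

/-- The initial memory: register `0` holds `n`, register `1` holds `m`, register `2` holds `root`,
natural arrays `0` and `1` hold the endpoints of the edges, real array `0` holds their weights;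
everything else is `0`. -/
def inputStore (L : EdgeList G m) (w : Sym2 (Fin n) → ℝ) (root : ℕ) : Store where
  natVar := fun x => if x = 0 then n else if x = 1 then m else if x = 2 then root else 0
  natArr := fun a i =>
    if h : i < m then
      if a = 0 then (L.src ⟨i, h⟩ : ℕ) else if a = 1 then (L.dst ⟨i, h⟩ : ℕ) else 0
    else 0
  realVar := fun _ => 0
  realArr := fun a i => if h : i < m then
      if a = 0 then w s(L.src ⟨i, h⟩, L.dst ⟨i, h⟩) else 0
    else 0

/-- The orientation in the memory: the `i`-th edge goes from its first to its second listed
endpoint if entry `i` of the natural array `2` is `0`, and the other way otherwise. -/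
def outDigraph (L : EdgeList G m) (s : Store) : Digraph (Fin n) where
  Adj u v := ∃ i : Fin m,
    (s.natArr 2 i = 0 ∧ u = L.src i ∧ v = L.dst i) ∨
    (s.natArr 2 i ≠ 0 ∧ u = L.dst i ∧ v = L.src i)

/-- The coefficients of the packing in the memory (their number is in natural register `3`). -/
def outCoeff (s : Store) (j : Fin (s.natVar 3)) : ℝ := s.realArr 1 j

/-- The `j`-th arborescence in the memory: the parent of `v ≠ r` is entry `j * n + v` of the
natural array `3`. -/
def outTree (s : Store) (r : Fin n) (j : Fin (s.natVar 3)) : Digraph (Fin n) where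
  Adj u v := v ≠ r ∧ s.natArr 3 (j * n + v) = u

/-- The memory holds an optimal `r`-acyclic orientation of `G`, whose minimum weighted indegree
(over the vertices other than `r`) is the value `k(G, w, r)` held in real register `0`. -/
structure HoldsOrientation (L : EdgeList G m) (w : Sym2 (Fin n) → ℝ) (r : Fin n)
    (s : Store) : Prop where
  rootedAcyclic : IsRootedAcyclic G r (outDigraph L s)
  value : s.realVar 0 = kRooted G w r
  min_inWeight : IsLeast {x | ∃ v, v ≠ r ∧ x = inWeight (outDigraph L s) w v} (kRooted G w r)
  max_packing : kd (outDigraph L s) w r = kRooted G w r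
  max_orientation : IsGreatest (rootedValues G w r) (kRooted G w r)

/-- The memory holds a solution of rBRP: an optimal `r`-acyclic orientation, the value
`k(G, w, r)`, and a packing of `r`-arborescences of that orientation with this value, which is
the largest possible. -/
structure HoldsRootedSolution (L : EdgeList G m) (w : Sym2 (Fin n) → ℝ) (r : Fin n)
    (s : Store) : Prop extends HoldsOrientation L w r s where
  packing : IsPacking (outDigraph L s) w r (outCoeff s) (outTree s r)
  packing_value : ∑ j, outCoeff s j = kRooted G w r
  packing_max : IsGreatest (packingValues (outDigraph L s) w r) (kRooted G w r)

/-- The memory holds a solution of BRP: natural register `2` holds a root `r` for which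
`k(G, w, r)` is the maximum `k(G, w)` over all roots, with a solution of rBRP for it. -/
def HoldsSolution (L : EdgeList G m) (w : Sym2 (Fin n) → ℝ) (s : Store) : Prop :=
  ∃ r : Fin n, s.natVar 2 = r ∧ HoldsRootedSolution L w r s ∧
    IsGreatest (broadcastValues G w) (kRooted G w r)

end InputOutput

end Broadcast

/-! The problem reduces to ordering the vertices. In an acyclic orientation whose only source is
`r`, choosing one entering arc for each other vertex always gives an `r`-arborescence, because
following parents goes back in the order and can stop only at `r`. Each arborescence uses exactly
one arc into each `v ≠ r`, so a packing is worth at most the minimum weighted indegree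
(`le_inWeight_of_mem_packingValues`). Conversely, as long as a packing is worth less than this
minimum, every `v ≠ r` has an unsaturated entering arc (`PackState.exists_arc`) and a further
arborescence fits. Giving it the largest possible coefficient either saturates an arc or reaches the
minimum, so that at most `2 * m + 1` arborescences are needed (`packProg_loop_runs`). Hence it
suffices to find an `r`-acyclic orientation that maximises the minimum weighted indegree
(`optimal_of_packing`).

A greedy order achieves this: start with `r` and repeatedly add the candidate that receives the most
weight from the vertices already added. If some orientation `D` has all indegrees at least `x`, then
a `D`-minimal vertex among those not yet added has all its `D`-predecessors added, and so receives
at least `x` (`Grow.exists_candidate`). The heaviest candidate therefore also receives at least `x`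
(`Grow.step`).

For the running time, all degrees are at least 2 by 2-connectedness, and a degree count shows that
there are never more than `2 * (m - n + 1)` candidates (`Grow.card_front_le`). The `n` scans for a
maximum thus take `O((m - n + 1) * n)` steps, and each arc is followed only once, when its tail is
added. An outer circuit has at most `n` edges, so `m - n` is at most the number of chords. BRP is
solved by trying all roots. -/

namespace Broadcast

/-! ### Program logic for the machine -/

section Logic

attribute [simp] NExp.eval NExp.cost RExp.eval RExp.cost BExp.Holds BExp.cost

infixr:60 "⨾" => Prog.seq

/-- The natural registers that a program may write to. -/
def Prog.natVars : Prog → List ℕ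
  | .setNat x _ => [x]
  | .seq p q => p.natVars ++ q.natVars
  | .branch _ p q => p.natVars ++ q.natVars
  | .loop _ p => p.natVars
  | _ => []

/-- The natural arrays that a program may write to. -/
def Prog.natArrs : Prog → List ℕ
  | .putNat a _ _ => [a]
  | .seq p q => p.natArrs ++ q.natArrs
  | .branch _ p q => p.natArrs ++ q.natArrs
  | .loop _ p => p.natArrs
  | _ => []

/-- The real registers that a program may write to. -/
def Prog.realVars : Prog → List ℕ
  | .setReal x _ => [x]
  | .seq p q => p.realVars ++ q.realVars
  | .branch _ p q => p.realVars ++ q.realVars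
  | .loop _ p => p.realVars
  | _ => []

/-- The real arrays that a program may write to. -/
def Prog.realArrs : Prog → List ℕ
  | .putReal a _ _ => [a]
  | .seq p q => p.realArrs ++ q.realArrs
  | .branch _ p q => p.realArrs ++ q.realArrs
  | .loop _ p => p.realArrs
  | _ => []

/-- The stores `s` and `s'` differ at most in what `p` may write to. -/
structure Frame (p : Prog) (s s' : Store) : Prop where
  natVar : ∀ x, x ∉ p.natVars → s'.natVar x = s.natVar x
  natArr : ∀ a, a ∉ p.natArrs → s'.natArr a = s.natArr a
  realVar : ∀ x, x ∉ p.realVars → s'.realVar x = s.realVar x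
  realArr : ∀ a, a ∉ p.realArrs → s'.realArr a = s.realArr a

theorem Frame.refl (p : Prog) (s : Store) : Frame p s s :=
  ⟨fun _ _ => rfl, fun _ _ => rfl, fun _ _ => rfl, fun _ _ => rfl⟩

theorem Frame.trans {p : Prog} {s s' s'' : Store} (h : Frame p s s') (h' : Frame p s' s'') :
    Frame p s s'' :=
  ⟨fun x hx => (h'.natVar x hx).trans (h.natVar x hx),
    fun x hx => (h'.natArr x hx).trans (h.natArr x hx),
    fun x hx => (h'.realVar x hx).trans (h.realVar x hx),
    fun x hx => (h'.realArr x hx).trans (h.realArr x hx)⟩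

theorem Frame.mono {p q : Prog} {s s' : Store} (h : Frame p s s')
    (h₁ : p.natVars ⊆ q.natVars) (h₂ : p.natArrs ⊆ q.natArrs)
    (h₃ : p.realVars ⊆ q.realVars) (h₄ : p.realArrs ⊆ q.realArrs) : Frame q s s' :=
  ⟨fun x hx => h.natVar x fun hh => hx (h₁ hh), fun x hx => h.natArr x fun hh => hx (h₂ hh),
    fun x hx => h.realVar x fun hh => hx (h₃ hh), fun x hx => h.realArr x fun hh => hx (h₄ hh)⟩

/-- What a program may write to is read off its syntax. Preservation of any other register or array
is thereby reduced to a list membership, settled by `decide` throughout the file. -/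
theorem Exec.frame {p : Prog} {s s' : Store} {T : ℕ} (h : Exec p s T s') : Frame p s s' := by
  induction h with
  | skip s => exact Frame.refl _ _
  | setNat s x e =>
    refine ⟨fun y hy => ?_, fun _ _ => rfl, fun _ _ => rfl, fun _ _ => rfl⟩
    exact Function.update_of_ne (by simpa [Prog.natVars] using hy) _ _
  | putNat s a i e =>
    refine ⟨fun _ _ => rfl, fun y hy => ?_, fun _ _ => rfl, fun _ _ => rfl⟩
    exact Function.update_of_ne (by simpa [Prog.natArrs] using hy) _ _
  | setReal s x e =>
    refine ⟨fun _ _ => rfl, fun _ _ => rfl, fun y hy => ?_, fun _ _ => rfl⟩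
    exact Function.update_of_ne (by simpa [Prog.realVars] using hy) _ _
  | putReal s a i e =>
    refine ⟨fun _ _ => rfl, fun _ _ => rfl, fun _ _ => rfl, fun y hy => ?_⟩
    exact Function.update_of_ne (by simpa [Prog.realArrs] using hy) _ _
  | seq _ _ ih ih' =>
    exact (ih.mono (List.subset_append_left _ _) (List.subset_append_left _ _)
      (List.subset_append_left _ _) (List.subset_append_left _ _)).trans
      (ih'.mono (List.subset_append_right _ _) (List.subset_append_right _ _)
        (List.subset_append_right _ _) (List.subset_append_right _ _))
  | branch_true _ _ ih =>
    exact ih.mono (List.subset_append_left _ _) (List.subset_append_left _ _)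
      (List.subset_append_left _ _) (List.subset_append_left _ _)
  | branch_false _ _ ih =>
    exact ih.mono (List.subset_append_right _ _) (List.subset_append_right _ _)
      (List.subset_append_right _ _) (List.subset_append_right _ _)
  | loop_true _ _ _ ih ih' =>
    exact Frame.trans (ih.mono (List.Subset.refl _) (List.Subset.refl _) (List.Subset.refl _)
      (List.Subset.refl _)) ih'
  | loop_false _ => exact Frame.refl _ _

/-- The program `p`, started on `s`, halts, with number of steps and final memory satisfying
`Q`. -/
def Runs (p : Prog) (s : Store) (Q : ℕ → Store → Prop) : Prop :=
  ∃ T s', Exec p s T s' ∧ Q T s'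

variable {p q : Prog} {s : Store} {Q R : ℕ → Store → Prop}

/-- The consequence rule also hands over the frame of the run, so specifications need to mention
only what a program changes. -/
theorem Runs.mono (h : Runs p s Q) (hQ : ∀ T s', Frame p s s' → Q T s' → R T s') :
    Runs p s R := by
  obtain ⟨T, s', he, hq⟩ := h
  exact ⟨T, s', he, hQ T s' he.frame hq⟩

theorem Runs.seq (h : Runs p s fun T s' => Runs q s' fun T' s'' => Q (T + T') s'') :
    Runs (p⨾q) s Q := by
  obtain ⟨T, s', he, T', s'', he', hq⟩ := h
  exact ⟨_, _, .seq he he', hq⟩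

-- This and the following equivalences are weakest-precondition rules: with them `simp` executes
-- loop-free code symbolically, its step count included.
@[simp]
theorem runs_skip : Runs .skip s Q ↔ Q 1 s :=
  ⟨fun ⟨_, _, he, hq⟩ => by cases he; exact hq, fun h => ⟨_, _, .skip s, h⟩⟩

@[simp]
theorem runs_setNat {x : ℕ} {e : NExp} : Runs (.setNat x e) s Q ↔
    Q (e.cost + 1) { s with natVar := Function.update s.natVar x (e.eval s) } :=
  ⟨fun ⟨_, _, he, hq⟩ => by cases he; exact hq, fun h => ⟨_, _, .setNat s x e, h⟩⟩

@[simp]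
theorem runs_putNat {a : ℕ} {i e : NExp} : Runs (.putNat a i e) s Q ↔
    Q (i.cost + e.cost + 1) { s with
      natArr := Function.update s.natArr a (Function.update (s.natArr a) (i.eval s) (e.eval s)) } :=
  ⟨fun ⟨_, _, he, hq⟩ => by cases he; exact hq, fun h => ⟨_, _, .putNat s a i e, h⟩⟩

@[simp]
theorem runs_setReal {x : ℕ} {e : RExp} : Runs (.setReal x e) s Q ↔
    Q (e.cost + 1) { s with realVar := Function.update s.realVar x (e.eval s) } :=
  ⟨fun ⟨_, _, he, hq⟩ => by cases he; exact hq, fun h => ⟨_, _, .setReal s x e, h⟩⟩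

@[simp]
theorem runs_putReal {a : ℕ} {i : NExp} {e : RExp} : Runs (.putReal a i e) s Q ↔
    Q (i.cost + e.cost + 1) { s with
      realArr := Function.update s.realArr a (Function.update (s.realArr a) (i.eval s) (e.eval s)) } :=
  ⟨fun ⟨_, _, he, hq⟩ => by cases he; exact hq, fun h => ⟨_, _, .putReal s a i e, h⟩⟩

@[simp]
theorem runs_seq : Runs (p⨾q) s Q ↔
    Runs p s fun T s' => Runs q s' fun T' s'' => Q (T + T') s'' := by
  refine ⟨fun ⟨_, _, he, hq⟩ => ?_, Runs.seq⟩
  cases he with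
  | seq h h' => exact ⟨_, _, h, _, _, h', hq⟩

@[simp]
theorem runs_branch {b : BExp} : Runs (.branch b p q) s Q ↔
    (b.Holds s → Runs p s fun T s' => Q (b.cost + 1 + T) s') ∧
    (¬ b.Holds s → Runs q s fun T s' => Q (b.cost + 1 + T) s') := by
  refine ⟨fun ⟨_, _, he, hq⟩ => ?_, fun ⟨h, h'⟩ => ?_⟩
  · cases he with
    | branch_true hb h => exact ⟨fun _ => ⟨_, _, h, hq⟩, fun hb' => absurd hb hb'⟩
    | branch_false hb h => exact ⟨fun hb' => absurd hb' hb, fun _ => ⟨_, _, h, hq⟩⟩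
  · by_cases hb : b.Holds s
    · obtain ⟨T, s', he, hq⟩ := h hb
      exact ⟨_, _, .branch_true hb he, hq⟩
    · obtain ⟨T, s', he, hq⟩ := h' hb
      exact ⟨_, _, .branch_false hb he, hq⟩

/-- Loop rule: the invariant `I k` carries a potential `k`, which pays for all further steps. -/
theorem Runs.loop {b : BExp} (I : ℕ → Store → Prop) {k : ℕ} (h0 : I k s)
    (step : ∀ k s', Frame p s s' → I k s' → b.Holds s' →
      Runs p s' fun T s'' => ∃ k', I k' s'' ∧ T + (b.cost + 1) + k' ≤ k) :
    Runs (.loop b p) s fun T s' => T ≤ k + (b.cost + 1) ∧ (∃ k' ≤ k, I k' s') ∧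
      ¬ b.Holds s' := by
  suffices ∀ k s', Frame p s s' → I k s' → Runs (.loop b p) s' fun T s'' =>
      T ≤ k + (b.cost + 1) ∧ (∃ k' ≤ k, I k' s'') ∧ ¬ b.Holds s'' from
    this k s (Frame.refl _ _) h0
  intro k
  -- Each round pays for its test, which costs at least one step. The potential thus drops strictly,
  -- and termination follows together with the time bound.
  induction k using Nat.strong_induction_on with
  | _ k ih =>
    intro s' hs' hI
    by_cases hb : b.Holds s'
    · obtain ⟨T, s'', he, k', hI', hk⟩ := step k s' hs' hI hb
      obtain ⟨T', s₃, he', hT', ⟨k'', hk'', hI''⟩, hn⟩ :=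
        ih k' (by omega) s'' (hs'.trans he.frame) hI'
      exact ⟨_, _, .loop_true hb he he', by omega, ⟨k'', by omega, hI''⟩, hn⟩
    · exact ⟨_, _, .loop_false hb, by omega, ⟨k, le_rfl, hI⟩, hb⟩

/-- Run `p` for the values `0, …, (register y) - 1` of register `x`. -/
def Prog.forTo (x y : ℕ) (p : Prog) : Prog :=
  .setNat x (.lit 0)⨾.loop (.neg (.natLe (.var y) (.var x)))
    (p⨾.setNat x (.plus (.var x) (.lit 1)))

/-- A round costs `c` for the body, 5 for the test and 4 for the increment; the 7 pays for the
initial assignment and the last, failing test. The invariant is required of the store whose counter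
has already been advanced. -/
theorem Runs.forTo {x y N : ℕ} (I : ℕ → Store → Prop) (c : ℕ)
    (hN : s.natVar y = N) (hxy : x ≠ y) (hx : x ∉ p.natVars) (hy : y ∉ p.natVars)
    (h0 : I 0 { s with natVar := Function.update s.natVar x 0 })
    (step : ∀ i s', i < N → Frame (Prog.forTo x y p) s s' → s'.natVar x = i → I i s' →
      Runs p s' fun T s'' => T ≤ c ∧
        I (i + 1) { s'' with natVar := Function.update s''.natVar x (i + 1) }) :
    Runs (Prog.forTo x y p) s fun T s' => T ≤ N * (c + 9) + 7 ∧ I N s' := by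
  refine Runs.seq (runs_setNat.2 ?_)
  set s₀ : Store := { s with natVar := Function.update s.natVar x ((NExp.lit 0).eval s) }
  have hfr₀ : Frame (Prog.forTo x y p) s s₀ := by
    refine ⟨fun z hz => ?_, fun _ _ => rfl, fun _ _ => rfl, fun _ _ => rfl⟩
    exact Function.update_of_ne (by simp [Prog.forTo, Prog.natVars] at hz; exact hz.1) _ _
  have hsub : ∀ s', Frame (p⨾.setNat x (.plus (.var x) (.lit 1))) s₀ s' →
      Frame (Prog.forTo x y p) s s' := fun s' h =>
    hfr₀.trans (h.mono (List.subset_append_right _ _) (List.subset_append_right _ _)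
      (List.subset_append_right _ _) (List.subset_append_right _ _))
  have hyF : y ∉ (Prog.forTo x y p).natVars := by
    simp [Prog.forTo, Prog.natVars, hy, hxy.symm]
  refine (Runs.loop (fun k s' => ∃ i ≤ N, k = (N - i) * (c + 9) ∧ s'.natVar x = i ∧ I i s')
    (k := N * (c + 9)) ⟨0, Nat.zero_le _, by simp, by simp, h0⟩ ?_).mono ?_
  · rintro k s' hfr ⟨i, hi, rfl, hxi, hI⟩ hb
    have hys : s'.natVar y = N := ((hsub s' hfr).natVar y hyF).trans hN
    have hiN : i < N := by
      simpa [BExp.Holds, NExp.eval, hxi, hys] using hb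
    refine Runs.seq ((step i s' hiN (hsub s' hfr) hxi hI).mono ?_)
    rintro T s'' hfr' ⟨hT, hI'⟩
    refine runs_setNat.2 ?_
    have hx' : s''.natVar x = i := (hfr'.natVar x hx).trans hxi
    refine ⟨(N - (i + 1)) * (c + 9), ⟨i + 1, hiN, rfl, by simp [NExp.eval, hx'], ?_⟩, ?_⟩
    · simpa [NExp.eval, hx'] using hI'
    · obtain ⟨d, rfl⟩ : ∃ d, N = i + 1 + d := ⟨N - (i + 1), by omega⟩
      have h1 : i + 1 + d - (i + 1) = d := by omega
      have h2 : i + 1 + d - i = d + 1 := by omega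
      rw [h1, h2]
      simp only [BExp.cost, NExp.cost]
      nlinarith
  · rintro T s' hfr ⟨hT, ⟨k', -, i, hi, -, hxi, hI⟩, hn⟩
    have hys : s'.natVar y = N := ((hsub s' (hfr.mono (List.Subset.refl _)
      (List.Subset.refl _) (List.Subset.refl _) (List.Subset.refl _))).natVar y hyF).trans hN
    have : N ≤ i := by simpa [BExp.Holds, NExp.eval, hxi, hys] using hn
    obtain rfl : i = N := le_antisymm hi this
    refine ⟨?_, hI⟩
    simp only [BExp.cost, NExp.cost] at hT ⊢
    omega

end Logic

/-! ### Packings and indegrees -/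

section PackingBound

variable {V : Type*}

/-- The empty packing, which makes the set under the supremum in `kd` nonempty. -/
theorem zero_mem_packingValues {D : Digraph V} {w : Sym2 V → ℝ} (r : V)
    (hw : ∀ u v, D.Adj u v → 0 ≤ w s(u, v)) : 0 ∈ packingValues D w r :=
  ⟨0, Fin.elim0, Fin.elim0, ⟨fun j => j.elim0, fun j => j.elim0, by simpa using hw⟩, by simp⟩

variable [Fintype V]

-- Weak duality: an arborescence has exactly one arc into `v`, so its coefficient is counted exactly
-- once in the total load of the arcs entering `v`.
open Classical in
theorem le_inWeight_of_mem_packingValues {D : Digraph V} {w : Sym2 V → ℝ} {r v : V} {x : ℝ}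
    (hx : x ∈ packingValues D w r) (hv : v ≠ r) : x ≤ inWeight D w v := by
  obtain ⟨t, lam, A, hP, rfl⟩ := hx
  have h1 : ∀ j, lam j = ∑ u, if (A j).Adj u v then lam j else 0 := by
    intro j
    obtain ⟨u, hu, huu⟩ := (hP.arborescence j).parent v hv
    rw [Finset.sum_eq_single u (fun b _ hb => if_neg fun h => hb (huu b h)) (by simp), if_pos hu]
  rw [Finset.sum_congr rfl fun j _ => h1 j, Finset.sum_comm]
  refine Finset.sum_le_sum fun u _ => ?_
  split_ifs with h
  · exact hP.capacity u v h
  · refine (Finset.sum_eq_zero fun j _ => if_neg fun hA => h ?_).le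
    exact (hP.arborescence j).le u v hA

/-- All vertices other than `r` have weighted indegree at least `x` in some `r`-acyclic
orientation of `G`. -/
def Feasible (G : SimpleGraph V) (w : Sym2 V → ℝ) (r : V) (x : ℝ) : Prop :=
  ∃ D, IsRootedAcyclic G r D ∧ ∀ v, v ≠ r → x ≤ inWeight D w v

/-- An `r`-acyclic orientation whose minimum weighted indegree `K` is the largest possible and is
attained by a packing is optimal. -/
theorem optimal_of_packing {G : SimpleGraph V} {w : Sym2 V → ℝ} {r : V} {D : Digraph V} {K : ℝ}
    (hw : ∀ e ∈ G.edgeSet, 0 ≤ w e) (hD : IsRootedAcyclic G r D)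
    (hmin : IsLeast {x | ∃ v, v ≠ r ∧ x = inWeight D w v} K)
    (hopt : ∀ x, Feasible G w r x → x ≤ K) (hK : K ∈ packingValues D w r) :
    kd D w r = K ∧ kRooted G w r = K ∧ IsGreatest (rootedValues G w r) K ∧
      IsGreatest (packingValues D w r) K := by
  have hg : IsGreatest (packingValues D w r) K := by
    obtain ⟨⟨v, hv, rfl⟩, -⟩ := hmin
    exact ⟨hK, fun x hx => le_inWeight_of_mem_packingValues hx hv⟩
  have hg' : IsGreatest (rootedValues G w r) K := by
    refine ⟨⟨D, hD, hg.csSup_eq.symm⟩, ?_⟩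
    rintro _ ⟨D', hD', rfl⟩
    -- By weak duality a packing value of `D'` is a lower bound for all its indegrees, so `D'`
    -- itself witnesses that this value is feasible.
    refine csSup_le ⟨0, zero_mem_packingValues r fun u v h => hw _ ?_⟩ fun x hx =>
      hopt x ⟨D', hD', fun v hv => le_inWeight_of_mem_packingValues hx hv⟩
    exact (hD'.orientation.adj_iff u v).2 (.inl h)
  exact ⟨hg.csSup_eq, hg'.csSup_eq, hg', hg⟩

end PackingBound

/-! ### Growing an order from the root -/

section Greedy

variable {n : ℕ} {G : SimpleGraph (Fin n)} {w : Sym2 (Fin n) → ℝ} {r : Fin n}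

/-- The orientation of `G` from smaller to larger marks. -/
def markDigraph (G : SimpleGraph (Fin n)) (mk : Fin n → ℕ) : Digraph (Fin n) where
  Adj u v := G.Adj u v ∧ mk u < mk v

theorem isRootedAcyclic_markDigraph {mk : Fin n → ℕ} (hinj : Function.Injective mk)
    (hpar : ∀ v, v ≠ r → ∃ u, G.Adj u v ∧ mk u < mk v) (hr : ∀ v, mk r ≤ mk v) :
    IsRootedAcyclic G r (markDigraph G mk) := by
  refine ⟨⟨fun u v => ⟨fun h => ?_, ?_⟩, fun u v h h' => ?_⟩, fun v h => ?_, fun v => ⟨?_, ?_⟩⟩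
  · rcases lt_or_gt_of_ne (hinj.ne h.ne) with hlt | hlt
    · exact .inl ⟨h, hlt⟩
    · exact .inr ⟨h.symm, hlt⟩
  · rintro (h | h)
    exacts [h.1, h.1.symm]
  · exact lt_asymm h.2 h'.2
  · have : ∀ u v, Relation.TransGen (markDigraph G mk).Adj u v → mk u < mk v := by
      intro u v h
      induction h with
      | single h => exact h.2
      | tail _ h ih => exact ih.trans h.2
    exact lt_irrefl _ (this v v h)
  · intro h
    by_contra hv
    obtain ⟨u, hu⟩ := hpar v hv
    exact h u hu
  · rintro rfl u h
    exact absurd h.2 (not_lt.2 (hr u))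

/-- Deleting one neighbour `u` of `r` leaves a connected graph with at least two vertices, in which
`r` has a second neighbour. -/
theorem IsTwoConnected.two_le_degree [Fintype (G.neighborSet r)] (h : IsTwoConnected G) :
    2 ≤ G.degree r := by
  classical
  have hn : 3 ≤ n := by simpa using h.three_le
  have : Nontrivial (Fin n) := Fin.nontrivial_iff_two_le.2 (by omega)
  obtain ⟨u, hu⟩ := h.connected.preconnected.exists_adj_of_nontrivial r
  obtain ⟨x, hx⟩ : ∃ x : Fin n, x ∉ ({r, u} : Finset (Fin n)) := by
    by_contra! hh
    have := Finset.card_le_card (fun x _ => hh x : (Finset.univ : Finset (Fin n)) ⊆ {r, u})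
    have h2 := Finset.card_le_two (a := r) (b := u)
    simp at this; omega
  simp only [Finset.mem_insert, Finset.mem_singleton, not_or] at hx
  have : Nontrivial ({u}ᶜ : Set (Fin n)) :=
    ⟨⟨r, hu.ne⟩, ⟨x, hx.2⟩, fun h => hx.1 (congrArg Subtype.val h).symm⟩
  obtain ⟨⟨y, hy⟩, hry⟩ := (h.no_cut u).preconnected.exists_adj_of_nontrivial ⟨r, hu.ne⟩
  have hry' : G.Adj r y := hry
  have : ({u, y} : Finset (Fin n)) ⊆ G.neighborFinset r := by
    intro z hz
    simp only [Finset.mem_insert, Finset.mem_singleton] at hz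
    rcases hz with rfl | rfl <;> simpa
  have hc := Finset.card_le_card this
  rwa [Finset.card_pair (Ne.symm hy), SimpleGraph.card_neighborFinset_eq_degree] at hc

open Classical in
/-- A state of the greedy construction of an order of the vertices: `mk v ≥ 2` is the rank of a
vertex `v` that has been added, `mk v = 1` marks the neighbours of these vertices, and `acc v` is
the total weight of the edges from the predecessors of `v`. -/
structure Grow (G : SimpleGraph (Fin n)) (w : Sym2 (Fin n) → ℝ) (r : Fin n) (mk : Fin n → ℕ)
    (acc : Fin n → ℝ) (cnt : ℕ) : Prop where
  card : (Finset.univ.filter fun v => 2 ≤ mk v).card + 2 = cnt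
  lt : ∀ v, 2 ≤ mk v → mk v < cnt
  inj : ∀ u v, 2 ≤ mk u → mk u = mk v → u = v
  -- While `cnt = 2` nothing has been added, and `r` is a candidate although it has no added
  -- neighbour.
  front : ∀ v, mk v = 1 ↔
    mk v < 2 ∧ ((∃ u, 2 ≤ mk u ∧ G.Adj u v) ∨ (cnt = 2 ∧ v = r))
  root : cnt = 2 ∨ mk r = 2
  -- For a vertex not yet added all added neighbours count. Once it is added, only those of smaller
  -- rank do, so its value is frozen and is finally its weighted indegree.
  acc_eq : ∀ v, acc v =
    ∑ u, if G.Adj u v ∧ 2 ≤ mk u ∧ (mk v < 2 ∨ mk u < mk v) then w s(u, v) else 0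
  parent : ∀ v, v ≠ r → 2 ≤ mk v → ∃ u, 2 ≤ mk u ∧ G.Adj u v ∧ mk u < mk v
  opt : ∀ x, Feasible G w r x → ∀ v, v ≠ r → 2 ≤ mk v → x ≤ acc v
  -- Adding `x ≠ r` removes one candidate and creates at most `deg x - 1` new ones, since a
  -- neighbour of `x` has been added before. The constant 2 covers the root, which has no such
  -- neighbour.
  few : (Finset.univ.filter fun v => mk v = 1).card +
    2 * (Finset.univ.filter fun v => 2 ≤ mk v).card ≤
      2 + ∑ v ∈ Finset.univ.filter (fun v => 2 ≤ mk v), G.degree v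

theorem Grow.start {mk : Fin n → ℕ} {acc : Fin n → ℝ} (hr : mk r = 1)
    (hne : ∀ v, v ≠ r → mk v = 0) (hacc : ∀ v, acc v = 0) : Grow G w r mk acc 2 := by
  classical
  have hlt : ∀ v, ¬ 2 ≤ mk v := by
    intro v; by_cases h : v = r
    · subst h; omega
    · have := hne v h; omega
  have h0 : (Finset.univ.filter fun v => 2 ≤ mk v) = ∅ :=
    Finset.filter_eq_empty_iff.2 fun v _ => hlt v
  have h1 : (Finset.univ.filter fun v => mk v = 1) = {r} := by
    ext v
    by_cases h : v = r
    · subst h; simp [hr]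
    · simp [h, hne v h]
  refine ⟨by simp [h0], fun v h => absurd h (hlt v), fun u v h => absurd h (hlt u), fun v => ?_,
    .inl rfl, fun v => ?_, fun v _ h => absurd h (hlt v), fun x _ v _ h => absurd h (hlt v), ?_⟩
  · by_cases h : v = r
    · subst h; simp [hr]
    · simp [h, hne v h, hlt]
  · simp [hacc, hlt]
  · simp [h0, h1]

/-- Among the vertices that have not been added, some candidate attains every feasible value. -/
theorem Grow.exists_candidate {mk : Fin n → ℕ} {acc : Fin n → ℝ} {cnt : ℕ}
    (h : Grow G w r mk acc cnt) (hw : ∀ e ∈ G.edgeSet, 0 ≤ w e) {x : ℝ}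
    (hx : Feasible G w r x) (hr : mk r = 2) {y : Fin n} (hy : mk y < 2) :
    ∃ v, mk v = 1 ∧ x ≤ acc v := by
  classical
  obtain ⟨D, hD, hxD⟩ := hx
  have hirr : Std.Irrefl (Relation.TransGen D.Adj) := ⟨hD.acyclic⟩
  have : IsTrans _ (Relation.TransGen D.Adj) := ⟨fun _ _ _ => Relation.TransGen.trans⟩
  have hwf : WellFounded (Relation.TransGen D.Adj) := Finite.wellFounded_of_trans_of_irrefl _
  -- A `D`-minimal vertex among those not yet added: all its `D`-predecessors have been added, so
  -- its accumulated weight contains its whole `D`-indegree, and the other terms are nonnegative.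
  obtain ⟨v, hv, hmin⟩ := hwf.has_min {v | mk v < 2} ⟨y, hy⟩
  have hv' : mk v < 2 := hv
  have hvr : v ≠ r := by rintro rfl; omega
  have hin : ∀ u, D.Adj u v → 2 ≤ mk u := by
    intro u hu
    by_contra hh
    exact hmin u (not_le.1 hh) (.single hu)
  obtain ⟨u, hu⟩ : ∃ u, D.Adj u v := by
    by_contra! hh
    exact hvr ((hD.source_iff v).1 hh)
  have hadj : ∀ u, D.Adj u v → G.Adj u v := fun u hu => (hD.orientation.adj_iff u v).2 (.inl hu)
  refine ⟨v, (h.front v).2 ⟨hv, .inl ⟨u, hin u hu, hadj u hu⟩⟩, (hxD v hvr).trans ?_⟩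
  rw [h.acc_eq v]
  refine Finset.sum_le_sum fun u _ => ?_
  by_cases hu : D.Adj u v
  · rw [if_pos hu, if_pos ⟨hadj u hu, hin u hu, .inl hv⟩]
  · rw [if_neg hu]
    split_ifs with hh
    · exact hw _ hh.1
    · exact le_rfl

/-- Adding a candidate of maximum accumulated weight. -/
theorem Grow.step {mk mk' : Fin n → ℕ} {acc acc' : Fin n → ℝ} {cnt : ℕ}
    (h : Grow G w r mk acc cnt) (hw : ∀ e ∈ G.edgeSet, 0 ≤ w e) {x : Fin n} (hx : mk x = 1)
    (hmax : ∀ v, mk v = 1 → acc v ≤ acc x) (hxx : mk' x = cnt)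
    (h0 : ∀ v, v ≠ x → mk v = 0 → G.Adj x v → mk' v = 1)
    (h1 : ∀ v, v ≠ x → ¬ (mk v = 0 ∧ G.Adj x v) → mk' v = mk v)
    (ha : ∀ v, v ≠ x → mk v < 2 → G.Adj x v → acc' v = acc v + w s(x, v))
    (ha' : ∀ v, ¬ (v ≠ x ∧ mk v < 2 ∧ G.Adj x v) → acc' v = acc v) :
    Grow G w r mk' acc' (cnt + 1) := by
  classical
  have hcnt : 2 ≤ cnt := by have := h.card; omega
  have hge : ∀ v, 2 ≤ mk' v ↔ v = x ∨ 2 ≤ mk v := by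
    intro v
    by_cases hv : v = x
    · subst hv; simp [hxx, hcnt]
    · by_cases hh : mk v = 0 ∧ G.Adj x v
      · simp [hv, h0 v hv hh.1 hh.2, hh.1]
      · simp [hv, h1 v hv hh]
  have heq : ∀ v, 2 ≤ mk v → mk' v = mk v := by
    intro v hv
    exact h1 v (by rintro rfl; omega) (by omega)
  have hS : (Finset.univ.filter fun v => 2 ≤ mk' v) =
      insert x (Finset.univ.filter fun v => 2 ≤ mk v) := by
    ext v; simp [hge]
  have hxS : x ∉ Finset.univ.filter fun v => 2 ≤ mk v := by simp [hx]
  have hr' : cnt = 2 → x = r := by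
    intro hc
    rcases ((h.front x).1 hx).2 with ⟨u, hu, -⟩ | hh
    · have : u ∈ Finset.univ.filter fun v => 2 ≤ mk v := by simpa
      have := Finset.card_pos.2 ⟨u, this⟩
      have := h.card
      omega
    · exact hh.2
  have hone : ∀ v, mk' v = 1 ↔ v ≠ x ∧ (mk v = 1 ∨ (mk v = 0 ∧ G.Adj x v)) := by
    intro v
    by_cases hv : v = x
    · subst hv; simp [hxx]; omega
    · by_cases hh : mk v = 0 ∧ G.Adj x v
      · simp [hv, h0 v hv hh.1 hh.2, hh]
      · simp only [ne_eq, hv, not_false_eq_true, h1 v hv hh, true_and]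
        tauto
  refine ⟨?_, ?_, ?_, ?_, ?_, ?_, ?_, ?_, ?_⟩
  · rw [hS, Finset.card_insert_of_notMem hxS, ← h.card]
  · intro v hv
    rcases (hge v).1 hv with rfl | hv'
    · omega
    · have := h.lt v hv'
      rw [heq v hv']; omega
  · intro u v hu huv
    have hv : 2 ≤ mk' v := huv ▸ hu
    rcases (hge u).1 hu with rfl | hu' <;> rcases (hge v).1 hv with rfl | hv'
    · rfl
    · have := h.lt v hv'
      rw [heq v hv'] at huv; omega
    · have := h.lt u hu'
      rw [heq u hu'] at huv; omega
    · exact h.inj u v hu' (by rw [← heq u hu', ← heq v hv', huv])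
  · intro v
    rw [hone, h.front v]
    have hv2 : mk' v < 2 ↔ v ≠ x ∧ mk v < 2 := by
      rw [← not_le, hge, not_or, not_le]
    rw [hv2]
    constructor
    · rintro ⟨hvx, ⟨hlt, ⟨u, hu, huv⟩ | ⟨hc, rfl⟩⟩ | ⟨hz, hadj⟩⟩
      · exact ⟨⟨hvx, hlt⟩, .inl ⟨u, (hge u).2 (.inr hu), huv⟩⟩
      · exact absurd (hr' hc).symm hvx
      · exact ⟨⟨hvx, by omega⟩, .inl ⟨x, (hge x).2 (.inl rfl), hadj⟩⟩
    · rintro ⟨⟨hvx, hlt⟩, ⟨u, hu, huv⟩ | ⟨hc, -⟩⟩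
      · refine ⟨hvx, ?_⟩
        rcases (hge u).1 hu with rfl | hu'
        · by_cases hz : mk v = 0
          · exact .inr ⟨hz, huv⟩
          · exact .inl ((h.front v).1 (by omega))
        · exact .inl ⟨hlt, .inl ⟨u, hu', huv⟩⟩
      · omega
  · right
    rcases h.root with hc | hr
    · rw [← hr' hc, hxx, hc]
    · rw [heq r (by omega), hr]
  · intro v
    by_cases hv : v ≠ x ∧ mk v < 2 ∧ G.Adj x v
    · obtain ⟨hvx, hlt, hadj⟩ := hv
      have hlt' : mk' v < 2 := by
        by_contra hh
        rcases (hge v).1 (not_lt.1 hh) with hh | hh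
        · exact hvx hh
        · omega
      rw [ha v hvx hlt hadj, h.acc_eq v]
      -- The new predecessor `x` is a separate summand: its mark was 1, so it was absent from the
      -- old sum.
      have h2 : w s(x, v) = ∑ u, if u = x then w s(u, v) else 0 := by simp
      rw [h2, ← Finset.sum_add_distrib]
      refine Finset.sum_congr rfl fun u _ => ?_
      by_cases hu : u = x
      · subst hu; simp [hx, hxx, hcnt, hadj, hlt']
      · simp [hu, hge, hlt, hlt']
    · rw [ha' v hv, h.acc_eq v]
      refine Finset.sum_congr rfl fun u _ => if_congr ?_ rfl rfl
      refine and_congr_right fun huv => ?_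
      by_cases hu : u = x
      · subst hu
        have hvx : v ≠ u := huv.ne.symm
        have h2 : 2 ≤ mk v := by
          by_contra hh; exact hv ⟨hvx, by omega, huv⟩
        have := h.lt v h2
        simp only [hx, hxx, heq v h2]; omega
      · have h2u : 2 ≤ mk' u ↔ 2 ≤ mk u := by simp [hge, hu]
        rw [h2u]
        refine and_congr_right fun hu2 => ?_
        rw [heq u hu2]
        by_cases hvx : v = x
        · subst hvx
          have := h.lt u hu2
          simp only [hx, hxx]; omega
        · by_cases h2 : 2 ≤ mk v
          · rw [heq v h2]
          · have : ¬ 2 ≤ mk' v := by simp [hge, hvx, h2]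
            omega
  · intro v hvr hv
    rcases (hge v).1 hv with rfl | hv'
    · rcases ((h.front v).1 hx).2 with ⟨u, hu, huv⟩ | hh
      · refine ⟨u, (hge u).2 (.inr hu), huv, ?_⟩
        rw [hxx, heq u hu]; exact h.lt u hu
      · exact absurd hh.2 hvr
    · obtain ⟨u, hu, huv, hlt⟩ := h.parent v hvr hv'
      exact ⟨u, (hge u).2 (.inr hu), huv, by rwa [heq u hu, heq v hv']⟩
  · intro y hy v hvr hv
    rcases (hge v).1 hv with rfl | hv'
    · rw [ha' v (by simp)]
      have hr2 : mk r = 2 := h.root.resolve_left fun hc => hvr (hr' hc)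
      -- Some candidate `z` receives at least `y`, and the vertex chosen receives at least as much
      -- as `z`.
      obtain ⟨z, hz, hyz⟩ := h.exists_candidate hw hy hr2 (y := v) (by omega)
      exact hyz.trans (hmax z hz)
    · rw [ha' v (by rintro ⟨-, hh, -⟩; omega)]
      exact h.opt y hy v hvr hv'
  · rw [hS, Finset.card_insert_of_notMem hxS, Finset.sum_insert hxS]
    have hfew := h.few
    have hsub : (Finset.univ.filter fun v => mk' v = 1) ⊆
        (Finset.univ.filter fun v => mk v = 1).erase x ∪
          (G.neighborFinset x).filter fun v => mk v = 0 := by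
      intro v hv
      simp only [Finset.mem_filter, Finset.mem_univ, true_and, hone] at hv
      simp only [Finset.mem_union, Finset.mem_erase, Finset.mem_filter, Finset.mem_univ, true_and,
        SimpleGraph.mem_neighborFinset]
      tauto
    have hc1 := (Finset.card_le_card hsub).trans (Finset.card_union_le _ _)
    have hxm : x ∈ Finset.univ.filter fun v => mk v = 1 := by simpa
    rw [Finset.card_erase_of_mem hxm] at hc1
    have hpos := Finset.card_pos.2 ⟨x, hxm⟩
    have hdeg : ((G.neighborFinset x).filter fun v => mk v = 0).card ≤ G.degree x := by
      rw [← SimpleGraph.card_neighborFinset_eq_degree]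
      exact Finset.card_filter_le _ _
    -- Unless `x` is the root, it has an added neighbour, which cannot become a new candidate; this
    -- saves one of its `deg x` neighbours. In the root case no vertex has been added and the
    -- constant 2 is spent.
    rcases ((h.front x).1 hx).2 with ⟨u, hu, hux⟩ | ⟨hc, hxr⟩
    · have : ((G.neighborFinset x).filter fun v => mk v = 0).card < G.degree x := by
        rw [← SimpleGraph.card_neighborFinset_eq_degree]
        refine Finset.card_lt_card (Finset.filter_ssubset.2 ⟨u, ?_, by omega⟩)
        simpa using hux.symm
      omega
    · have hS0 : (Finset.univ.filter fun v => 2 ≤ mk v) = ∅ := by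
        have := h.card
        exact Finset.card_eq_zero.1 (by omega)
      have h11 : (Finset.univ.filter fun v => mk v = 1).card ≤ 1 := by
        refine Finset.card_le_one.2 ?_
        have : ∀ v, mk v = 1 → v = r := by
          intro v hv
          rcases ((h.front v).1 hv).2 with ⟨u, hu, -⟩ | hh
          · have : u ∈ Finset.univ.filter fun v => 2 ≤ mk v := by simpa
            rw [hS0] at this; simp at this
          · exact hh.2
        intro a ha b hb
        simp only [Finset.mem_filter, Finset.mem_univ, true_and] at ha hb
        rw [this a ha, this b hb]
      rw [hS0]
      simp only [Finset.card_empty, Finset.sum_empty]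
      omega

/-- The construction stops only when all vertices have been added. -/
theorem Grow.complete {mk : Fin n → ℕ} {acc : Fin n → ℝ} {cnt : ℕ}
    (h : Grow G w r mk acc cnt) (hG : G.Connected) (h1 : ∀ v, mk v ≠ 1) (v : Fin n) :
    2 ≤ mk v := by
  classical
  have hr : mk r = 2 := by
    refine h.root.resolve_left fun hc => h1 r ((h.front r).2 ⟨?_, .inr ⟨hc, rfl⟩⟩)
    by_contra hh
    have := h.lt r (not_lt.1 hh)
    omega
  by_contra hv
  obtain ⟨p⟩ := hG.preconnected r v
  -- A walk from the root to a missing vertex leaves the set of added vertices along some edge, and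
  -- the far end of that edge would be a candidate.
  obtain ⟨d, -, hd, hd'⟩ := p.exists_boundary_dart {u | 2 ≤ mk u} (by simp [hr]) hv
  exact h1 d.snd ((h.front d.snd).2 ⟨not_le.1 hd', .inl ⟨d.fst, hd, d.adj⟩⟩)

/-- The number of candidates is at most twice the cyclomatic number. -/
theorem Grow.card_front_le {mk : Fin n → ℕ} {acc : Fin n → ℝ} {cnt m : ℕ}
    (h : Grow G w r mk acc cnt) (hG : IsTwoConnected G) (hm : G.edgeSet.ncard = m) :
    (Finset.univ.filter fun v => mk v = 1).card ≤ 2 * (m - n + 1) := by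
  classical
  have hfew := h.few
  have hsum := G.sum_degrees_eq_twice_card_edges
  rw [← Set.ncard_coe_finset, SimpleGraph.coe_edgeFinset, hm,
    ← Finset.sum_filter_add_sum_filter_not Finset.univ (fun v => 2 ≤ mk v)] at hsum
  -- Vertices not yet added also have degree at least 2. Subtracting their part from the degree sum
  -- `2 * m` turns `few` into the bound `2 + 2 * m - 2 * n`.
  have h2 : 2 * (Finset.univ.filter fun v => ¬ 2 ≤ mk v).card ≤
      ∑ v ∈ Finset.univ.filter (fun v => ¬ 2 ≤ mk v), G.degree v := by
    rw [mul_comm, ← smul_eq_mul, ← Finset.sum_const]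
    exact Finset.sum_le_sum fun v _ => hG.two_le_degree
  have hn := Finset.card_filter_add_card_filter_not (s := (Finset.univ : Finset (Fin n)))
    (fun v => 2 ≤ mk v)
  rw [Finset.card_univ, Fintype.card_fin] at hn
  omega

end Greedy

/-! ### Arcs and adjacency lists -/

section Arcs

variable {n m : ℕ} {G : SimpleGraph (Fin n)} {w : Sym2 (Fin n) → ℝ} {r : Fin n}
  {L : EdgeList G m}

theorem EdgeList.ncard_edgeSet (L : EdgeList G m) : G.edgeSet.ncard = m := by
  rw [← L.range_eq, ← Set.image_univ, Set.ncard_image_of_injective _ L.injective, Set.ncard_univ,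
    Nat.card_eq_fintype_card, Fintype.card_fin]

theorem EdgeList.adj (L : EdgeList G m) (i : Fin m) : G.Adj (L.src i) (L.dst i) := by
  rw [← SimpleGraph.mem_edgeSet, ← L.range_eq]
  exact ⟨i, rfl⟩

theorem EdgeList.exists_of_adj (L : EdgeList G m) {u v : Fin n} (h : G.Adj u v) :
    ∃ i, (u = L.src i ∧ v = L.dst i) ∨ (u = L.dst i ∧ v = L.src i) := by
  rw [← SimpleGraph.mem_edgeSet, ← L.range_eq] at h
  obtain ⟨i, hi⟩ := h
  refine ⟨i, ?_⟩
  rcases Sym2.eq_iff.1 hi with h | h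
  · exact .inl ⟨h.1.symm, h.2.symm⟩
  · exact .inr ⟨h.2.symm, h.1.symm⟩

/-- The memory holds the input `(G, w, r)`. -/
structure HasInput (L : EdgeList G m) (w : Sym2 (Fin n) → ℝ) (r : Fin n) (s : Store) :
    Prop where
  size : s.natVar 0 = n
  edges : s.natVar 1 = m
  root : s.natVar 2 = r
  src : ∀ i : Fin m, s.natArr 0 i = L.src i
  dst : ∀ i : Fin m, s.natArr 1 i = L.dst i
  weight : ∀ i : Fin m, s.realArr 0 i = w s(L.src i, L.dst i)

theorem hasInput_inputStore (L : EdgeList G m) (w : Sym2 (Fin n) → ℝ) (r : Fin n) :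
    HasInput L w r (inputStore L w r) := by
  constructor <;> simp [inputStore]

/-- The arrays `tl`, `hd` and `wt` list the `N` arcs (edges with a direction) of `G` with their
tails, heads and weights. -/
structure IsArcs (G : SimpleGraph (Fin n)) (w : Sym2 (Fin n) → ℝ) (N : ℕ) (tl hd : ℕ → ℕ)
    (wt : ℕ → ℝ) : Prop where
  arc : ∀ e < N, ∃ u v : Fin n, G.Adj u v ∧ tl e = u ∧ hd e = v ∧ wt e = w s(u, v)
  inj : ∀ e < N, ∀ e' < N, tl e = tl e' → hd e = hd e' → e = e'
  surj : ∀ u v : Fin n, G.Adj u v → ∃ e < N, tl e = u ∧ hd e = v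

/-- Entries `i` and `m + i` are the two directions of edge `i`. Arcs with equal tails and equal
heads come from the same edge, and its two directions differ because there are no loops. -/
theorem isArcs_of_edgeList (L : EdgeList G m) {tl hd : ℕ → ℕ} {wt : ℕ → ℝ}
    (h : ∀ i : Fin m, tl i = L.src i ∧ hd i = L.dst i ∧ wt i = w s(L.src i, L.dst i) ∧
      tl (m + i) = L.dst i ∧ hd (m + i) = L.src i ∧ wt (m + i) = w s(L.src i, L.dst i)) :
    IsArcs G w (m + m) tl hd wt := by
  have key : ∀ e < m + m, (∃ i : Fin m, e = i ∧ tl e = L.src i ∧ hd e = L.dst i ∧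
      wt e = w s(L.src i, L.dst i)) ∨ (∃ i : Fin m, e = m + i ∧ tl e = L.dst i ∧
      hd e = L.src i ∧ wt e = w s(L.dst i, L.src i)) := by
    intro e he
    by_cases hlt : e < m
    · obtain ⟨h1, h2, h3, -⟩ := h ⟨e, hlt⟩
      exact .inl ⟨⟨e, hlt⟩, rfl, h1, h2, h3⟩
    · obtain ⟨-, -, -, h1, h2, h3⟩ := h ⟨e - m, by omega⟩
      have : m + (e - m) = e := by omega
      simp only [this] at h1 h2 h3
      exact .inr ⟨⟨e - m, by omega⟩, this.symm, h1, h2, by rw [h3, Sym2.eq_swap]⟩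
  refine ⟨fun e he => ?_, fun e he e' he' ht hh => ?_, fun u v huv => ?_⟩
  · rcases key e he with ⟨i, -, h1, h2, h3⟩ | ⟨i, -, h1, h2, h3⟩
    · exact ⟨_, _, L.adj i, h1, h2, h3⟩
    · exact ⟨_, _, (L.adj i).symm, h1, h2, h3⟩
  · rcases key e he with ⟨i, hi, h1, h2, -⟩ | ⟨i, hi, h1, h2, -⟩ <;>
    rcases key e' he' with ⟨j, hj, h1', h2', -⟩ | ⟨j, hj, h1', h2', -⟩ <;>
    rw [h1, h1', Fin.val_inj] at ht <;> rw [h2, h2', Fin.val_inj] at hh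
    · rw [hi, hj, L.injective (show s(L.src i, L.dst i) = s(L.src j, L.dst j) by rw [ht, hh])]
    · have hij := L.injective (show s(L.src i, L.dst i) = s(L.src j, L.dst j) by
        rw [ht, hh, Sym2.eq_swap])
      subst hij
      exact absurd ht (L.adj i).ne
    · have hij := L.injective (show s(L.src i, L.dst i) = s(L.src j, L.dst j) by
        rw [ht, hh, Sym2.eq_swap])
      subst hij
      exact absurd hh (L.adj i).ne
    · rw [hi, hj, L.injective (show s(L.src i, L.dst i) = s(L.src j, L.dst j) by rw [ht, hh])]
  · obtain ⟨i, ⟨rfl, rfl⟩ | ⟨rfl, rfl⟩⟩ := L.exists_of_adj huv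
    · exact ⟨i, by omega, (h i).1, (h i).2.1⟩
    · exact ⟨m + i, by omega, (h i).2.2.2.1, (h i).2.2.2.2.1⟩

/-- Write the two arcs of each edge into the natural arrays `4` (tails), `5` (heads) and the real
array `2` (weights), and their number into register `5`. -/
def arcProg : Prog :=
  .setNat 5 (.plus (.var 1) (.var 1))⨾
  .forTo 4 1
    (.putNat 4 (.var 4) (.get 0 (.var 4))⨾
    .putNat 5 (.var 4) (.get 1 (.var 4))⨾
    .putReal 2 (.var 4) (.get 0 (.var 4))⨾
    .putNat 4 (.plus (.var 1) (.var 4)) (.get 1 (.var 4))⨾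
    .putNat 5 (.plus (.var 1) (.var 4)) (.get 0 (.var 4))⨾
    .putReal 2 (.plus (.var 1) (.var 4)) (.get 0 (.var 4)))

theorem arcProg_runs {s : Store} (h : HasInput L w r s) :
    Runs arcProg s fun T s' => T ≤ 50 * m + 20 ∧ s'.natVar 5 = m + m ∧
      IsArcs G w (m + m) (s'.natArr 4) (s'.natArr 5) (s'.realArr 2) := by
  simp only [arcProg, runs_seq, runs_setNat]
  refine (Runs.forTo (N := m) (fun i s' => ∀ j : Fin m, j.val < i →
    s'.natArr 4 j = L.src j ∧ s'.natArr 5 j = L.dst j ∧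
    s'.realArr 2 j = w s(L.src j, L.dst j) ∧
    s'.natArr 4 (m + j) = L.dst j ∧ s'.natArr 5 (m + j) = L.src j ∧
    s'.realArr 2 (m + j) = w s(L.src j, L.dst j)) 31 (by simpa using h.edges) (by decide)
    (by decide) (by decide) (by simp) ?_).mono ?_
  · intro i s' hi hfr hx hI
    have h0 := hfr.natArr 0 (by decide)
    have h1 := hfr.natArr 1 (by decide)
    have h2 := hfr.realArr 0 (by decide)
    have h3 := hfr.natVar 1 (by decide)
    simp only [] at h0 h1 h2 h3
    simp at h3
    have hs := h.src ⟨i, hi⟩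
    have hd := h.dst ⟨i, hi⟩
    have hw := h.weight ⟨i, hi⟩
    simp only [] at hs hd hw
    simp [Function.update_apply, hx, h0, h1, h2, h3, h.edges, hs, hd, hw]
    intro j hj
    rcases lt_or_eq_of_le hj with hj | hj
    · have := hI j hj
      have h1 : (j : ℕ) ≠ i := by omega
      have h2 : (j : ℕ) ≠ m + i := by omega
      have h3 : m + (j : ℕ) ≠ i := by omega
      simpa [h1, h2, h3] using this
    · obtain rfl : j = ⟨i, hi⟩ := Fin.ext hj
      have h1 : m ≠ 0 := by omega
      simp [h1]
  · rintro T s' hfr ⟨hT, hI⟩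
    refine ⟨by simp; omega, ?_, isArcs_of_edgeList L fun i => hI i i.2⟩
    rw [hfr.natVar 5 (by decide)]
    simp [h.edges]

/-- One more than the largest `e < i` with `tl e = v`, and `0` if there is none. -/
def lastArc (tl : ℕ → ℕ) (v : ℕ) : ℕ → ℕ
  | 0 => 0
  | i + 1 => if tl i = v then i + 1 else lastArc tl v i

theorem lastArc_le (tl : ℕ → ℕ) (v i : ℕ) : lastArc tl v i ≤ i := by
  induction i with
  | zero => exact le_rfl
  | succ i ih => rw [lastArc]; split_ifs <;> omega

theorem tl_lastArc {tl : ℕ → ℕ} {v i : ℕ} (h : 1 ≤ lastArc tl v i) :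
    tl (lastArc tl v i - 1) = v := by
  induction i with
  | zero => simp [lastArc] at h
  | succ i ih =>
    rw [lastArc] at h ⊢
    split_ifs with hh
    · exact hh
    · exact ih (by rwa [if_neg hh] at h)

theorem tl_ne_of_lastArc_le {tl : ℕ → ℕ} {v i e : ℕ} (h : lastArc tl v i ≤ e) (he : e < i) :
    tl e ≠ v := by
  induction i with
  | zero => omega
  | succ i ih =>
    rw [lastArc] at h
    split_ifs at h with hh
    · omega
    · rcases Nat.lt_succ_iff_lt_or_eq.1 he with he | rfl
      · exact ih h he
      · exact hh

/-- Clear the list heads (natural array `7`), the marks (natural array `8`) and the accumulated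
weights (real array `3`) of all vertices. -/
def clearProg : Prog :=
  .forTo 6 0 (.putNat 7 (.var 6) (.lit 0)⨾.putNat 8 (.var 6) (.lit 0)⨾.putReal 3 (.var 6) .zero)

theorem clearProg_runs {s : Store} (h : s.natVar 0 = n) :
    Runs clearProg s fun T s' => T ≤ 20 * n + 20 ∧
      ∀ v < n, s'.natArr 7 v = 0 ∧ s'.natArr 8 v = 0 ∧ s'.realArr 3 v = 0 := by
  refine (Runs.forTo (N := n) (fun i s' => ∀ v < i,
    s'.natArr 7 v = 0 ∧ s'.natArr 8 v = 0 ∧ s'.realArr 3 v = 0) 9 h (by decide)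
    (by decide) (by decide) (by simp) ?_).mono ?_
  · intro i s' hi hfr hx hI
    simp [Function.update_apply, hx]
    intro v hv
    rcases lt_or_eq_of_le hv with hv | rfl
    · have h1 : v ≠ i := by omega
      simpa [h1] using hI v hv
    · simp
  · rintro T s' hfr ⟨hT, hI⟩
    exact ⟨by omega, hI⟩

/-- Build the linked lists of the arcs with a given tail: heads in the natural array `7`, links in
the natural array `6`. -/
def linkProg : Prog :=
  .forTo 7 5 (.putNat 6 (.var 7) (.get 7 (.get 4 (.var 7)))⨾
    .putNat 7 (.get 4 (.var 7)) (.plus (.var 7) (.lit 1)))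

/-- After `i` arcs the head of the list of `v` is `lastArc tl v i`. A link therefore points to the
previous arc with the same tail, and a list is traversed by decreasing index; pointers are shifted
by one so that 0 ends the list. -/
theorem linkProg_runs {s : Store} {N : ℕ} (hN : s.natVar 5 = N) (h7 : ∀ v < n, s.natArr 7 v = 0)
    (ht : ∀ e < N, s.natArr 4 e < n) :
    Runs linkProg s fun T s' => T ≤ 20 * N + 20 ∧
      (∀ e < N, s'.natArr 6 e = lastArc (s.natArr 4) (s.natArr 4 e) e) ∧
      ∀ v < n, s'.natArr 7 v = lastArc (s.natArr 4) v N := by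
  refine (Runs.forTo (N := N) (fun i s' =>
    (∀ e < i, s'.natArr 6 e = lastArc (s.natArr 4) (s.natArr 4 e) e) ∧
      ∀ v < n, s'.natArr 7 v = lastArc (s.natArr 4) v i) 11 hN (by decide)
    (by decide) (by decide) (by simpa [lastArc] using h7) ?_).mono ?_
  · rintro i s' hi hfr hx ⟨hI, hI'⟩
    have h4 := hfr.natArr 4 (by decide)
    simp only [runs_seq, runs_putNat, NExp.eval, NExp.cost, hx, h4]
    refine ⟨by norm_num, fun e he => ?_, fun v hv => ?_⟩
    · rcases Nat.lt_succ_iff_lt_or_eq.1 he with he | rfl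
      · have h1 : e ≠ i := by omega
        simpa [Function.update_apply, h1] using hI e he
      · simpa [Function.update_apply] using hI' _ (ht e hi)
    · rw [lastArc]
      by_cases hh : s.natArr 4 i = v
      · subst hh
        simp [h4]
      · simp [h4, hh, Ne.symm hh, hI' v hv]
  · rintro T s' hfr ⟨hT, hI⟩
    exact ⟨by omega, hI⟩

end Arcs

/-! ### The greedy construction on the machine -/

section GrowProg

variable {n m : ℕ} {G : SimpleGraph (Fin n)} {w : Sym2 (Fin n) → ℝ} {r : Fin n}
  {L : EdgeList G m}

/-- `F 0, …, F (f - 1)` lists the vertices with mark `1`. -/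
structure IsListing (n : ℕ) (mk F : ℕ → ℕ) (f : ℕ) : Prop where
  lt : ∀ j < f, F j < n
  inj : ∀ j < f, ∀ j' < f, F j = F j' → j = j'
  mem : ∀ v < n, mk v = 1 ↔ ∃ j < f, F j = v

theorem IsListing.le_card {mk F : ℕ → ℕ} {f : ℕ} (h : IsListing n mk F f) :
    f ≤ (Finset.univ.filter fun v : Fin n => mk v = 1).card := by
  have h1 : ((Finset.range f).image F).card = f := by
    rw [Finset.card_image_of_injOn, Finset.card_range]
    intro j hj j' hj' hh
    exact h.inj j (by simpa using hj) j' (by simpa using hj') hh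
  have h2 : (Finset.range f).image F ⊆
      (Finset.univ.filter fun v : Fin n => mk v = 1).map Fin.valEmbedding := by
    intro v hv
    obtain ⟨j, hj, rfl⟩ := Finset.mem_image.1 hv
    have hj := Finset.mem_range.1 hj
    have hlt := h.lt j hj
    exact Finset.mem_map.2 ⟨⟨F j, hlt⟩, by simpa using (h.mem _ hlt).2 ⟨j, hj, rfl⟩, rfl⟩
  have := Finset.card_le_card h2
  rwa [h1, Finset.card_map] at this

/-- The last entry moves into the gap, so that a removal takes boundedly many steps. -/
theorem IsListing.remove {mk F : ℕ → ℕ} {f p c : ℕ} (h : IsListing n mk F f) (hp : p < f)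
    (hc : 2 ≤ c) :
    IsListing n (Function.update mk (F p) c) (Function.update F p (F (f - 1))) (f - 1) := by
  refine ⟨fun j hj => ?_, fun j hj j' hj' hh => ?_, fun v hv => ?_⟩
  · simp only [Function.update_apply]
    split_ifs
    · exact h.lt _ (by omega)
    · exact h.lt _ (by omega)
  · simp only [Function.update_apply] at hh
    split_ifs at hh with h1 h2 h2
    · omega
    · have := h.inj _ (by omega) _ (by omega) hh
      omega
    · have := h.inj _ (by omega) _ (by omega) hh
      omega
    · exact h.inj _ (by omega) _ (by omega) hh
  · by_cases hvp : v = F p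
    · subst hvp
      simp only [Function.update_self]
      refine ⟨fun hh => by omega, ?_⟩
      rintro ⟨j, hj, hh⟩
      simp only [Function.update_apply] at hh
      split_ifs at hh with h1
      · have := h.inj _ (by omega) _ (by omega) hh
        omega
      · have := h.inj _ (by omega) _ (by omega) hh
        omega
    · rw [Function.update_of_ne hvp, h.mem v hv]
      constructor
      · rintro ⟨j, hj, rfl⟩
        by_cases hjf : j = f - 1
        · subst hjf
          refine ⟨p, ?_, Function.update_self ..⟩
          by_contra hh
          exact hvp (congrArg F (by omega))
        · exact ⟨j, by omega, Function.update_of_ne (by rintro rfl; exact hvp rfl) _ _⟩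
      · rintro ⟨j, hj, rfl⟩
        simp only [Function.update_apply]
        split_ifs
        · exact ⟨f - 1, by omega, rfl⟩
        · exact ⟨j, by omega, rfl⟩

theorem IsListing.push {mk F : ℕ → ℕ} {f u : ℕ} (h : IsListing n mk F f) (hu : u < n)
    (h0 : mk u = 0) :
    IsListing n (Function.update mk u 1) (Function.update F f u) (f + 1) := by
  have hne : ∀ j < f, F j ≠ u := by
    rintro j hj rfl
    have := (h.mem _ hu).2 ⟨j, hj, rfl⟩
    omega
  refine ⟨fun j hj => ?_, fun j hj j' hj' hh => ?_, fun v hv => ?_⟩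
  · simp only [Function.update_apply]
    split_ifs
    · exact hu
    · exact h.lt _ (by omega)
  · simp only [Function.update_apply] at hh
    split_ifs at hh with h1 h2 h2
    · omega
    · exact absurd hh.symm (hne _ (by omega))
    · exact absurd hh (hne _ (by omega))
    · exact h.inj _ (by omega) _ (by omega) hh
  · by_cases hvu : v = u
    · subst hvu
      simp only [Function.update_self, true_iff]
      exact ⟨f, by omega, Function.update_self ..⟩
    · rw [Function.update_of_ne hvu, h.mem v hv]
      constructor
      · rintro ⟨j, hj, rfl⟩
        exact ⟨j, by omega, Function.update_of_ne (by omega) _ _⟩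
      · rintro ⟨j, hj, rfl⟩
        by_cases hjf : j = f
        · subst hjf; simp at hvu
        · rw [Function.update_of_ne hjf]
          exact ⟨j, by omega, rfl⟩

/-- Find a position (register `10`) of maximum accumulated weight in the list of candidates
(natural array `9`, with length in register `8`). -/
def scanProg : Prog :=
  .setNat 10 (.lit 0)⨾
  .forTo 11 8
    (.branch (.realLe (.get 3 (.get 9 (.var 10))) (.get 3 (.get 9 (.var 11))))
      (.setNat 10 (.var 11)) .skip)

theorem scanProg_runs {s : Store} {f : ℕ} (hf : s.natVar 8 = f) (hpos : 0 < f) :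
    Runs scanProg s fun T s' => T ≤ 20 * f + 20 ∧ s'.natVar 10 < f ∧
      ∀ j < f, s.realArr 3 (s.natArr 9 j) ≤ s.realArr 3 (s.natArr 9 (s'.natVar 10)) := by
  simp only [scanProg, runs_seq, runs_setNat]
  refine (Runs.forTo (N := f) (fun i s' => s'.natVar 10 < f ∧
      ∀ j < i, s.realArr 3 (s.natArr 9 j) ≤ s.realArr 3 (s.natArr 9 (s'.natVar 10))) 11
      (by simpa using hf) (by decide)
    (by decide) (by decide) (by simpa using hpos) ?_).mono ?_
  · rintro i s' hi hfr hx ⟨hI, hI'⟩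
    have h3 : s'.realArr 3 = s.realArr 3 := hfr.realArr 3 (by decide)
    have h9 : s'.natArr 9 = s.natArr 9 := hfr.natArr 9 (by decide)
    simp only [runs_branch, runs_setNat, runs_skip, BExp.Holds, BExp.cost, RExp.eval, RExp.cost,
      NExp.eval, NExp.cost, h3, h9, hx]
    refine ⟨fun hb => ⟨by norm_num, by simpa using hi, fun j hj => ?_⟩,
      fun hb => ⟨by norm_num, by simpa using hI, fun j hj => ?_⟩⟩
    · simp only [ne_eq, not_false_eq_true, Nat.reduceEqDiff, Function.update_of_ne,
        Function.update_self]
      rcases Nat.lt_succ_iff_lt_or_eq.1 hj with hj | rfl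
      · exact (hI' j hj).trans hb
      · exact le_rfl
    · simp only [ne_eq, Nat.reduceEqDiff, not_false_eq_true, Function.update_of_ne]
      rcases Nat.lt_succ_iff_lt_or_eq.1 hj with hj | rfl
      · exact hI' j hj
      · exact (not_le.1 hb).le
  · rintro T s' hfr ⟨hT, hI⟩
    exact ⟨by simp; omega, hI⟩

/-- Follow the list of the arcs with tail in register `12`, from the pointer in register `13`, and
update marks, accumulated weights and candidates. -/
def adjProg : Prog :=
  .loop (.natLe (.lit 1) (.var 13))
    (.setNat 14 (.get 5 (.minus (.var 13) (.lit 1)))⨾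
    .branch (.natLe (.get 8 (.var 14)) (.lit 1))
      (.putReal 3 (.var 14) (.plus (.get 3 (.var 14)) (.get 2 (.minus (.var 13) (.lit 1))))⨾
      .branch (.natLe (.get 8 (.var 14)) (.lit 0))
        (.putNat 8 (.var 14) (.lit 1)⨾
        .putNat 9 (.var 8) (.var 14)⨾
        .setNat 8 (.plus (.var 8) (.lit 1)))
        .skip)
      .skip⨾
    .setNat 13 (.get 6 (.minus (.var 13) (.lit 1))))

/-- Some arc from `x` to `v` has an index at least `c`. -/
def ArcFrom (tl hd : ℕ → ℕ) (N x c v : ℕ) : Prop :=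
  ∃ e, c ≤ e ∧ e < N ∧ tl e = x ∧ hd e = v

/-- A pointer `c` means that the arcs of index at least `c` are done. Following a link skips no arc
with tail `x`, so arc `c - 1` is the only one newly covered. -/
theorem arcFrom_lastArc {tl hd : ℕ → ℕ} {N x c v : ℕ} (hc : 1 ≤ c) (hcN : c ≤ N)
    (ht : tl (c - 1) = x) :
    ArcFrom tl hd N x (lastArc tl x (c - 1)) v ↔ ArcFrom tl hd N x c v ∨ v = hd (c - 1) := by
  have hle := lastArc_le tl x (c - 1)
  constructor
  · rintro ⟨e, h1, h2, h3, h4⟩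
    rcases lt_trichotomy e (c - 1) with h | h | h
    · exact absurd h3 (tl_ne_of_lastArc_le h1 h)
    · exact .inr (by rw [← h4, h])
    · exact .inl ⟨e, by omega, h2, h3, h4⟩
  · rintro (⟨e, h1, h2, h3, h4⟩ | rfl)
    · exact ⟨e, by omega, h2, h3, h4⟩
    · exact ⟨c - 1, hle, by omega, ht, rfl⟩

/-- The invariant says that exactly the heads of arcs at or above the pointer have been updated. The
potential charges 60 steps to each arc out of `x` below the pointer. -/
theorem adjProg_runs {s : Store} {N : ℕ} {x : Fin n}
    (hA : IsArcs G w N (s.natArr 4) (s.natArr 5) (s.realArr 2))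
    (h6 : ∀ e < N, s.natArr 6 e = lastArc (s.natArr 4) (s.natArr 4 e) e)
    (hx : s.natVar 13 = lastArc (s.natArr 4) x N)
    (hl : IsListing n (s.natArr 8) (s.natArr 9) (s.natVar 8)) :
    Runs adjProg s fun T s' =>
      T ≤ 60 * ((Finset.range N).filter fun e => s.natArr 4 e = x).card + 20 ∧
      IsListing n (s'.natArr 8) (s'.natArr 9) (s'.natVar 8) ∧
      (∀ v : Fin n, s.natArr 8 v = 0 ∧ G.Adj x v → s'.natArr 8 v = 1) ∧
      (∀ v : Fin n, ¬ (s.natArr 8 v = 0 ∧ G.Adj x v) → s'.natArr 8 v = s.natArr 8 v) ∧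
      (∀ v : Fin n, s.natArr 8 v < 2 ∧ G.Adj x v →
        s'.realArr 3 v = s.realArr 3 v + w s(x, v)) ∧
      (∀ v : Fin n, ¬ (s.natArr 8 v < 2 ∧ G.Adj x v) → s'.realArr 3 v = s.realArr 3 v) := by
  set tl := s.natArr 4 with htl
  set hd := s.natArr 5 with hhd
  set wt := s.realArr 2 with hwt
  have hN : ∀ v, ¬ ArcFrom tl hd N x N v := fun v ⟨e, h1, h2, _⟩ => by omega
  have hlast : ∀ v, ArcFrom tl hd N x (lastArc tl x N) v ↔ ArcFrom tl hd N x N v :=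
    fun v => ⟨fun ⟨e, h1, h2, h3, _⟩ => absurd h3 (tl_ne_of_lastArc_le h1 h2),
      fun h => absurd h (hN v)⟩
  refine (Runs.loop (fun k s' => s'.natVar 13 ≤ N ∧
      (1 ≤ s'.natVar 13 → tl (s'.natVar 13 - 1) = x) ∧
      k = 60 * ((Finset.range (s'.natVar 13)).filter fun e => tl e = x).card ∧
      IsListing n (s'.natArr 8) (s'.natArr 9) (s'.natVar 8) ∧
      (∀ v : Fin n, s.natArr 8 v = 0 ∧ ArcFrom tl hd N x (s'.natVar 13) v → s'.natArr 8 v = 1) ∧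
      (∀ v : Fin n, ¬ (s.natArr 8 v = 0 ∧ ArcFrom tl hd N x (s'.natVar 13) v) →
        s'.natArr 8 v = s.natArr 8 v) ∧
      (∀ v : Fin n, s.natArr 8 v < 2 ∧ ArcFrom tl hd N x (s'.natVar 13) v →
        s'.realArr 3 v = s.realArr 3 v + w s(x, v)) ∧
      (∀ v : Fin n, ¬ (s.natArr 8 v < 2 ∧ ArcFrom tl hd N x (s'.natVar 13) v) →
        s'.realArr 3 v = s.realArr 3 v))
    (k := 60 * ((Finset.range (s.natVar 13)).filter fun e => tl e = x).card) ?_ ?_).mono ?_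
  · rw [hx]
    refine ⟨lastArc_le _ _ _, tl_lastArc, rfl, hl, ?_, fun _ _ => rfl, ?_, fun _ _ => rfl⟩
    · rintro v ⟨-, h⟩
      exact absurd ((hlast v).1 h) (hN v)
    · rintro v ⟨-, h⟩
      exact absurd ((hlast v).1 h) (hN v)
  · rintro k s' hfr ⟨hcN, htc, rfl, hl', hm1, hm0, ha1, ha0⟩ hb
    have h4 : s'.natArr 4 = tl := hfr.natArr 4 (by decide)
    have h5 : s'.natArr 5 = hd := hfr.natArr 5 (by decide)
    have h6' : s'.natArr 6 = s.natArr 6 := hfr.natArr 6 (by decide)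
    have h2 : s'.realArr 2 = wt := hfr.realArr 2 (by decide)
    obtain ⟨c, hc⟩ : ∃ c, s'.natVar 13 = c := ⟨_, rfl⟩
    simp only [hc] at hcN htc hm1 hm0 ha1 ha0 hb ⊢
    have hc1 : 1 ≤ c := by simpa [hc] using hb
    have ht := htc hc1
    obtain ⟨x', u, hxu, hx', hu, hwu⟩ := hA.arc (c - 1) (by omega)
    have hxx : x' = x := Fin.ext (hx'.symm.trans ht)
    subst hxx
    -- No two arcs have the same ends, so `u` has not been treated before: its mark and accumulated
    -- weight are still the initial ones, and its weight is added only once.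
    have hnu : ¬ ArcFrom tl hd N x' c u := by
      rintro ⟨e, h1, h2, h3, h4⟩
      have := hA.inj e h2 (c - 1) (by omega) (h3.trans ht.symm) (h4.trans hu.symm)
      omega
    have hstep : ∀ v : Fin n, ArcFrom tl hd N x' (lastArc tl x' (c - 1)) v ↔
        ArcFrom tl hd N x' c v ∨ v = u := by
      intro v
      rw [arcFrom_lastArc hc1 hcN ht, hu, Fin.val_inj]
    have hnext : s'.natArr 6 (c - 1) = lastArc tl x' (c - 1) := by
      rw [h6', h6 (c - 1) (by omega), ht]
    have hle := lastArc_le tl x' (c - 1)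
    have hcard : ((Finset.range (lastArc tl x' (c - 1))).filter fun e => tl e = x').card <
        ((Finset.range c).filter fun e => tl e = x').card := by
      refine Finset.card_lt_card (Finset.ssubset_iff_of_subset ?_ |>.2 ⟨c - 1, ?_, ?_⟩)
      · exact Finset.filter_subset_filter _ (Finset.range_subset_range.2 (by omega))
      · simp only [Finset.mem_filter, Finset.mem_range]
        exact ⟨by omega, ht⟩
      · simp only [Finset.mem_filter, Finset.mem_range]
        omega
    have hmu : s'.natArr 8 u = s.natArr 8 u := hm0 u fun h => hnu h.2
    have hau : s'.realArr 3 u = s.realArr 3 u := ha0 u fun h => hnu h.2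
    simp only [runs_seq, runs_setNat, runs_branch, runs_putReal, runs_putNat, runs_skip,
      NExp.eval, RExp.eval, BExp.Holds, NExp.cost, RExp.cost, BExp.cost, Function.update_self,
      ne_eq, Nat.reduceEqDiff, not_false_eq_true, Function.update_of_ne, hc, h5, hu, hnext, h2,
      hwu, hmu, hau]
    refine ⟨fun hle1 => ⟨fun hle0 => ?_, fun hle0 => ?_⟩, fun hle1 => ?_⟩ <;>
    refine ⟨_, ⟨by omega, tl_lastArc, rfl, ?_, ?_, ?_, ?_, ?_⟩, by omega⟩
    · exact hl'.push u.2 (by omega)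
    · intro v hv
      rw [hstep] at hv
      by_cases hvu : v = u
      · simp [hvu]
      · simpa [Function.update_apply, Fin.val_inj, hvu] using hm1 v (by tauto)
    · intro v hv
      rw [hstep] at hv
      have hvu : v ≠ u := by rintro rfl; exact hv ⟨by omega, .inr rfl⟩
      simpa [Function.update_apply, Fin.val_inj, hvu] using hm0 v (by tauto)
    · intro v hv
      rw [hstep] at hv
      by_cases hvu : v = u
      · simp [hvu]
      · simpa [Function.update_apply, Fin.val_inj, hvu] using ha1 v (by tauto)
    · intro v hv
      rw [hstep] at hv
      have hvu : v ≠ u := by rintro rfl; exact hv ⟨by omega, .inr rfl⟩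
      simpa [Function.update_apply, Fin.val_inj, hvu] using ha0 v (by tauto)
    · exact hl'
    · intro v hv
      rw [hstep] at hv
      have hvu : v ≠ u := by rintro rfl; omega
      exact hm1 v (by tauto)
    · intro v hv
      rw [hstep] at hv
      exact hm0 v (by tauto)
    · intro v hv
      rw [hstep] at hv
      by_cases hvu : v = u
      · simp [hvu]
      · simpa [Function.update_apply, Fin.val_inj, hvu] using ha1 v (by tauto)
    · intro v hv
      rw [hstep] at hv
      have hvu : v ≠ u := by rintro rfl; exact hv ⟨by omega, .inr rfl⟩
      simpa [Function.update_apply, Fin.val_inj, hvu] using ha0 v (by tauto)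
    · exact hl'
    · intro v hv
      rw [hstep] at hv
      have hvu : v ≠ u := by rintro rfl; omega
      exact hm1 v (by tauto)
    · intro v hv
      rw [hstep] at hv
      exact hm0 v (by tauto)
    · intro v hv
      rw [hstep] at hv
      have hvu : v ≠ u := by rintro rfl; omega
      exact ha1 v (by tauto)
    · intro v hv
      rw [hstep] at hv
      exact ha0 v (by tauto)
  · rintro T s' hfr ⟨hT, ⟨k', hk', hcN, htc, rfl, hl', hm1, hm0, ha1, ha0⟩, hb⟩
    have hc0 : s'.natVar 13 = 0 := by simpa using hb
    have hiff : ∀ v : Fin n, ArcFrom tl hd N x 0 v ↔ G.Adj x v := by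
      intro v
      constructor
      · rintro ⟨e, -, he, h1, h2⟩
        obtain ⟨a, b, hab, ha, hb, -⟩ := hA.arc e he
        rwa [← Fin.ext (ha.symm.trans h1), ← Fin.ext (hb.symm.trans h2)]
      · intro h
        obtain ⟨e, he, h1, h2⟩ := hA.surj x v h
        exact ⟨e, Nat.zero_le _, he, h1, h2⟩
    simp only [hc0, hiff] at hm1 hm0 ha1 ha0
    refine ⟨?_, hl', hm1, hm0, ha1, ha0⟩
    have : ((Finset.range (s.natVar 13)).filter fun e => tl e = x).card ≤
        ((Finset.range N).filter fun e => tl e = x).card :=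
      Finset.card_le_card (Finset.filter_subset_filter _ (Finset.range_subset_range.2
        (hx ▸ lastArc_le _ _ _)))
    simp at hT
    omega

end GrowProg

/-! ### The complete greedy algorithm: order, orientation, minimum indegree -/

section Solve

variable {n m : ℕ} {G : SimpleGraph (Fin n)} {w : Sym2 (Fin n) → ℝ} {r : Fin n}
  {L : EdgeList G m}

/-- Remove the candidate at the position in register `10` from the list, put it into register
`12`, give it the next rank (register `9`), and put the head of its list of arcs into register
`13`. -/
def extractProg : Prog :=
  .setNat 12 (.get 9 (.var 10))⨾
  .putNat 9 (.var 10) (.get 9 (.minus (.var 8) (.lit 1)))⨾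
  .setNat 8 (.minus (.var 8) (.lit 1))⨾
  .putNat 8 (.var 12) (.var 9)⨾
  .setNat 9 (.plus (.var 9) (.lit 1))⨾
  .setNat 13 (.get 7 (.var 12))

theorem extractProg_runs {s : Store} :
    Runs extractProg s fun T s' => T ≤ 40 ∧
      s'.natArr 9 = Function.update (s.natArr 9) (s.natVar 10) (s.natArr 9 (s.natVar 8 - 1)) ∧
      s'.natVar 8 = s.natVar 8 - 1 ∧
      s'.natArr 8 =
        Function.update (s.natArr 8) (s.natArr 9 (s.natVar 10)) (s.natVar 9) ∧
      s'.natVar 9 = s.natVar 9 + 1 ∧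
      s'.natVar 13 = s.natArr 7 (s.natArr 9 (s.natVar 10)) := by
  simp [extractProg]

/-- The greedy construction of an order of the vertices, starting from the root. -/
def growProg : Prog :=
  .setNat 8 (.lit 1)⨾
  .putNat 9 (.lit 0) (.var 2)⨾
  .putNat 8 (.var 2) (.lit 1)⨾
  .setNat 9 (.lit 2)⨾
  .loop (.natLe (.lit 1) (.var 8)) (scanProg⨾extractProg⨾adjProg)

/-- The potential has two parts. Each vertex still to be added pays for a scan of at most `2 * (m -
n + 1)` candidates and a constant overhead; each arc whose tail has not been added pays 60 for being
followed. -/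
theorem growProg_loop_runs {s : Store} {N : ℕ} (hG : IsTwoConnected G)
    (hw : ∀ e ∈ G.edgeSet, 0 ≤ w e) (hm : G.edgeSet.ncard = m)
    (hA : IsArcs G w N (s.natArr 4) (s.natArr 5) (s.realArr 2))
    (h6 : ∀ e < N, s.natArr 6 e = lastArc (s.natArr 4) (s.natArr 4 e) e)
    (h7 : ∀ v < n, s.natArr 7 v = lastArc (s.natArr 4) v N)
    (hl : IsListing n (s.natArr 8) (s.natArr 9) (s.natVar 8))
    (hg : Grow G w r (fun v => s.natArr 8 v) (fun v => s.realArr 3 v) (s.natVar 9)) :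
    Runs (.loop (.natLe (.lit 1) (.var 8)) (scanProg⨾extractProg⨾adjProg)) s fun T s' =>
      T ≤ n * (40 * (m - n + 1) + 100) + 60 * N + 10 ∧
      Grow G w r (fun v => s'.natArr 8 v) (fun v => s'.realArr 3 v) (s'.natVar 9) ∧
      ∀ v : Fin n, 2 ≤ s'.natArr 8 v := by
  have hcnt : ∀ {mk : Fin n → ℕ} {acc : Fin n → ℝ} {cnt : ℕ}, Grow G w r mk acc cnt →
      cnt ≤ n + 2 := by
    intro mk acc cnt h
    have h1 := h.card
    have h2 := Finset.card_le_univ (Finset.univ.filter fun v => 2 ≤ mk v)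
    rw [Fintype.card_fin] at h2
    omega
  refine (Runs.loop (fun k s' =>
      k = (n + 2 - s'.natVar 9) * (40 * (m - n + 1) + 100) +
        60 * ((Finset.range N).filter fun e => s'.natArr 8 (s.natArr 4 e) < 2).card ∧
      IsListing n (s'.natArr 8) (s'.natArr 9) (s'.natVar 8) ∧
      Grow G w r (fun v => s'.natArr 8 v) (fun v => s'.realArr 3 v) (s'.natVar 9))
    ⟨rfl, hl, hg⟩ ?_).mono ?_
  · rintro k s₁ hfr ⟨rfl, hl₁, hg₁⟩ hb
    have h4 : s₁.natArr 4 = s.natArr 4 := hfr.natArr 4 (by decide)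
    have h5 : s₁.natArr 5 = s.natArr 5 := hfr.natArr 5 (by decide)
    have h6' : s₁.natArr 6 = s.natArr 6 := hfr.natArr 6 (by decide)
    have h7' : s₁.natArr 7 = s.natArr 7 := hfr.natArr 7 (by decide)
    have h2 : s₁.realArr 2 = s.realArr 2 := hfr.realArr 2 (by decide)
    have hpos : 1 ≤ s₁.natVar 8 := by simpa using hb
    have hf : s₁.natVar 8 ≤ 2 * (m - n + 1) := hl₁.le_card.trans (hg₁.card_front_le hG hm)
    refine Runs.seq ((scanProg_runs rfl hpos).mono ?_)
    rintro T₁ s₂ hfr₂ ⟨hT₁, hp, hmax⟩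
    refine Runs.seq (extractProg_runs.mono ?_)
    rintro T₂ s₃ hfr₃ ⟨hT₂, e9, e8, em, ec, e13⟩
    rw [hfr₂.natArr 9 (by decide)] at e9 em e13
    rw [hfr₂.natVar 8 (by decide)] at e9 e8
    rw [hfr₂.natArr 8 (by decide), hfr₂.natVar 9 (by decide)] at em
    rw [hfr₂.natVar 9 (by decide)] at ec
    rw [hfr₂.natArr 7 (by decide), h7'] at e13
    set p := s₂.natVar 10
    obtain ⟨x, hx⟩ : ∃ x : Fin n, s₁.natArr 9 p = x := ⟨⟨_, hl₁.lt p hp⟩, rfl⟩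
    have hmx : s₁.natArr 8 x = 1 := (hl₁.mem x x.2).2 ⟨p, hp, hx⟩
    have hc2 : 2 ≤ s₁.natVar 9 := by have := hg₁.card; omega
    have f4 : s₃.natArr 4 = s.natArr 4 := by
      rw [hfr₃.natArr 4 (by decide), hfr₂.natArr 4 (by decide), h4]
    have f5 : s₃.natArr 5 = s.natArr 5 := by
      rw [hfr₃.natArr 5 (by decide), hfr₂.natArr 5 (by decide), h5]
    have f6 : s₃.natArr 6 = s.natArr 6 := by
      rw [hfr₃.natArr 6 (by decide), hfr₂.natArr 6 (by decide), h6']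
    have f2 : s₃.realArr 2 = s.realArr 2 := by
      rw [hfr₃.realArr 2 (by decide), hfr₂.realArr 2 (by decide), h2]
    have f3 : s₃.realArr 3 = s₁.realArr 3 := by
      rw [hfr₃.realArr 3 (by decide), hfr₂.realArr 3 (by decide)]
    have hl₃ : IsListing n (s₃.natArr 8) (s₃.natArr 9) (s₃.natVar 8) := by
      rw [em, e9, e8]
      exact hl₁.remove hp hc2
    rw [hx] at em e13
    refine (adjProg_runs (x := x) (by rwa [f4, f5, f2]) (by rwa [f6, f4])
      (by rw [e13, f4, h7 x x.2]) hl₃).mono ?_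
    rintro T₃ s₄ hfr₄ ⟨hT₃, hl₄, hm1, hm0, ha1, ha0⟩
    have f9 : s₄.natVar 9 = s₁.natVar 9 + 1 := by rw [hfr₄.natVar 9 (by decide), ec]
    have hne : ∀ v : Fin n, v ≠ x → s₃.natArr 8 v = s₁.natArr 8 v := fun v hv => by
      rw [em, Function.update_of_ne (by simpa [Fin.val_inj] using hv)]
    have hxx : s₃.natArr 8 x = s₁.natVar 9 := by rw [em, Function.update_self]
    have hg₄ : Grow G w r (fun v => s₄.natArr 8 v) (fun v => s₄.realArr 3 v)
        (s₁.natVar 9 + 1) := by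
      refine hg₁.step hw (x := x) hmx ?_ ?_ ?_ ?_ ?_ ?_
      · intro v hv
        obtain ⟨j, hj, hjv⟩ := (hl₁.mem v v.2).1 hv
        have := hmax j hj
        rwa [hjv, hx] at this
      · rw [← hxx]
        exact hm0 x fun h => G.loopless.irrefl x h.2
      · intro v hv hz hadj
        exact hm1 v ⟨by rw [hne v hv, hz], hadj⟩
      · intro v hv hh
        rw [← hne v hv] at hh ⊢
        exact hm0 v hh
      · intro v hv hz hadj
        rw [← f3]
        exact ha1 v ⟨by rwa [hne v hv], hadj⟩
      · intro v hh
        rw [← f3]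
        refine ha0 v fun h => hh ⟨?_, ?_, h.2⟩
        · rintro rfl; exact G.loopless.irrefl v h.2
        · rw [← hne v (by rintro rfl; exact G.loopless.irrefl v h.2)]; exact h.1
    refine ⟨_, ⟨rfl, hl₄, by rwa [f9]⟩, ?_⟩
    have hle := hcnt hg₄
    rw [f4] at hT₃
    -- The arcs with tail `x` leave the potential for good now that `x` has a rank, and this pays
    -- for following its list.
    have hcard : ((Finset.range N).filter fun e => s.natArr 4 e = x).card +
        ((Finset.range N).filter fun e => s₄.natArr 8 (s.natArr 4 e) < 2).card ≤
        ((Finset.range N).filter fun e => s₁.natArr 8 (s.natArr 4 e) < 2).card := by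
      have hx4 : s₄.natArr 8 x = s₁.natVar 9 := by
        rw [← hxx]; exact hm0 x fun h => G.loopless.irrefl x h.2
      rw [← Finset.card_union_of_disjoint]
      · refine Finset.card_le_card (Finset.union_subset ?_ ?_)
        · intro e he
          simp only [Finset.mem_filter] at he ⊢
          exact ⟨he.1, by rw [he.2, hmx]; norm_num⟩
        · intro e he
          simp only [Finset.mem_filter, Finset.mem_range] at he ⊢
          refine ⟨he.1, ?_⟩
          obtain ⟨u, v, -, hu, -⟩ := hA.arc e he.1
          rw [hu] at he ⊢
          by_contra hh
          have hux : u ≠ x := by rintro rfl; omega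
          have := hm0 u (by rw [hne u hux]; omega)
          rw [hne u hux] at this
          omega
      · refine Finset.disjoint_left.2 fun e he he' => ?_
        simp only [Finset.mem_filter] at he he'
        rw [he.2, hx4] at he'
        omega
    obtain ⟨d, hd⟩ : ∃ d, n + 2 - s₁.natVar 9 = d + 1 := ⟨n + 1 - s₁.natVar 9, by omega⟩
    have hd' : n + 2 - s₄.natVar 9 = d := by omega
    rw [hd, hd', add_mul, one_mul]
    simp only [BExp.cost, NExp.cost]
    omega
  · rintro T s' hfr ⟨hT, ⟨k', -, -, hl', hg'⟩, hb⟩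
    have hf0 : s'.natVar 8 = 0 := by simpa using hb
    refine ⟨?_, hg', hg'.complete hG.connected fun v hv => ?_⟩
    · have h1 := Finset.card_filter_le (Finset.range N) fun e => s.natArr 8 (s.natArr 4 e) < 2
      rw [Finset.card_range] at h1
      have h2 : n + 2 - s.natVar 9 ≤ n := by have := hg.card; omega
      have h3 := Nat.mul_le_mul_right (40 * (m - n + 1) + 100) h2
      simp only [BExp.cost, NExp.cost] at hT
      omega
    · obtain ⟨j, hj, -⟩ := (hl'.mem v v.2).1 hv
      omega

theorem growProg_runs {s : Store} {N : ℕ} (hG : IsTwoConnected G)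
    (hw : ∀ e ∈ G.edgeSet, 0 ≤ w e) (hm : G.edgeSet.ncard = m) (hr : s.natVar 2 = r)
    (hA : IsArcs G w N (s.natArr 4) (s.natArr 5) (s.realArr 2))
    (h6 : ∀ e < N, s.natArr 6 e = lastArc (s.natArr 4) (s.natArr 4 e) e)
    (h7 : ∀ v < n, s.natArr 7 v = lastArc (s.natArr 4) v N)
    (h8 : ∀ v < n, s.natArr 8 v = 0) (h3 : ∀ v < n, s.realArr 3 v = 0) :
    Runs growProg s fun T s' =>
      T ≤ n * (40 * (m - n + 1) + 100) + 60 * N + 30 ∧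
      Grow G w r (fun v => s'.natArr 8 v) (fun v => s'.realArr 3 v) (s'.natVar 9) ∧
      ∀ v : Fin n, 2 ≤ s'.natArr 8 v := by
  simp only [growProg, runs_seq, runs_setNat, runs_putNat, NExp.eval, NExp.cost, ne_eq,
    not_false_eq_true, Function.update_of_ne, Nat.reduceEqDiff, hr]
  refine (growProg_loop_runs (r := r) (N := N) hG hw hm ?_ ?_ ?_ ?_ ?_).mono ?_
  · simpa using hA
  · simpa using h6
  · simpa using h7
  · have := (show IsListing n (s.natArr 8) (s.natArr 9) 0 from
      ⟨by simp, by simp, fun v hv => by simp [h8 v hv]⟩).push r.2 (h8 r r.2)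
    simpa using this
  · refine Grow.start (by simp) (fun v hv => ?_) fun v => by simpa using h3 v v.2
    simp [Fin.val_inj, hv, h8]
  · rintro T s' - ⟨hT, h⟩
    exact ⟨by omega, h⟩

/-- Orient each edge from the smaller to the larger mark. -/
def orientProg : Prog :=
  .forTo 4 1
    (.branch (.natLe (.get 8 (.get 0 (.var 4))) (.get 8 (.get 1 (.var 4))))
      (.putNat 2 (.var 4) (.lit 0)) (.putNat 2 (.var 4) (.lit 1)))

theorem orientProg_runs {s : Store} (h : HasInput L w r s)
    (hinj : Function.Injective fun v : Fin n => s.natArr 8 v) :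
    Runs orientProg s fun T s' => T ≤ 30 * m + 20 ∧
      outDigraph L s' = markDigraph G fun v => s.natArr 8 v := by
  refine (Runs.forTo (N := m) (fun i s' => ∀ j : Fin m, j.val < i →
    (s'.natArr 2 j = 0 ↔ s.natArr 8 (L.src j) ≤ s.natArr 8 (L.dst j))) 12 h.edges (by decide)
    (by decide) (by decide) (by simp) ?_).mono ?_
  · intro i s' hi hfr hx hI
    have h0 := hfr.natArr 0 (by decide)
    have h1 := hfr.natArr 1 (by decide)
    have h8 := hfr.natArr 8 (by decide)
    have hs := h.src ⟨i, hi⟩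
    have hd := h.dst ⟨i, hi⟩
    simp only [] at hs hd
    simp only [runs_branch, runs_putNat, BExp.Holds, NExp.eval, BExp.cost, NExp.cost, hx, h0, h1,
      h8, hs, hd]
    refine ⟨fun hb => ⟨by norm_num, fun j hj => ?_⟩, fun hb => ⟨by norm_num, fun j hj => ?_⟩⟩ <;>
    rcases Nat.lt_succ_iff_lt_or_eq.1 hj with hj | hj
    · have h1 : (j : ℕ) ≠ i := by omega
      simpa [h1] using hI j hj
    · obtain rfl : j = ⟨i, hi⟩ := Fin.ext hj
      simpa using hb
    · have h1 : (j : ℕ) ≠ i := by omega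
      simpa [h1] using hI j hj
    · obtain rfl : j = ⟨i, hi⟩ := Fin.ext hj
      simpa using hb
  · rintro T s' hfr ⟨hT, hI⟩
    refine ⟨by omega, ?_⟩
    ext u v
    constructor
    · rintro ⟨i, ⟨h0, rfl, rfl⟩ | ⟨h0, rfl, rfl⟩⟩
      · exact ⟨L.adj i, lt_of_le_of_ne ((hI i i.2).1 h0) (hinj.ne (L.adj i).ne)⟩
      · exact ⟨(L.adj i).symm, not_le.1 fun hh => h0 ((hI i i.2).2 hh)⟩
    · rintro ⟨hadj, hlt⟩
      obtain ⟨i, ⟨rfl, rfl⟩ | ⟨rfl, rfl⟩⟩ := L.exists_of_adj hadj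
      · exact ⟨i, .inl ⟨(hI i i.2).2 hlt.le, rfl, rfl⟩⟩
      · exact ⟨i, .inr ⟨fun hh => absurd ((hI i i.2).1 hh) (not_le.2 hlt), rfl, rfl⟩⟩

/-- Put the minimum of the accumulated weights of the vertices other than the root into the real
register `0`. -/
def minProg : Prog :=
  .branch (.natLe (.var 2) (.lit 0)) (.setReal 0 (.get 3 (.lit 1))) (.setReal 0 (.get 3 (.lit 0)))⨾
  .forTo 6 0
    (.branch (.both (.natLe (.var 6) (.var 2)) (.natLe (.var 2) (.var 6))) .skip
      (.branch (.realLe (.get 3 (.var 6)) (.var 0)) (.setReal 0 (.get 3 (.var 6))) .skip))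

theorem minProg_runs {s : Store} (hn : s.natVar 0 = n) (hn2 : 2 ≤ n) (hr : s.natVar 2 = r) :
    Runs minProg s fun T s' => T ≤ 40 * n + 30 ∧
      IsLeast {x | ∃ v : Fin n, v ≠ r ∧ x = s.realArr 3 v} (s'.realVar 0) := by
  refine Runs.seq (Q := fun T s' => _) ?_
  -- The minimum starts from vertex 1 if the root is vertex 0 and from vertex 0 otherwise, in either
  -- case from a vertex other than the root.
  have h1 : Runs (.branch (.natLe (.var 2) (.lit 0)) (.setReal 0 (.get 3 (.lit 1)))
      (.setReal 0 (.get 3 (.lit 0)))) s fun T s' => T ≤ 10 ∧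
      ∃ v : Fin n, v ≠ r ∧ s'.realVar 0 = s.realArr 3 v := by
    simp only [runs_branch, runs_setReal, BExp.Holds, NExp.eval, RExp.eval, BExp.cost, NExp.cost,
      RExp.cost, hr, Function.update_self]
    refine ⟨fun hb => ⟨by norm_num, ⟨1, by omega⟩, ?_, rfl⟩,
      fun hb => ⟨by norm_num, ⟨0, by omega⟩, ?_, rfl⟩⟩
    · intro hh
      have := congrArg Fin.val hh
      simp only [] at this
      omega
    · intro hh
      have := congrArg Fin.val hh
      simp only [] at this
      omega
  refine h1.mono ?_
  rintro T₁ s₁ hfr₁ ⟨hT₁, v₀, hv₀, hs₁⟩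
  have e3 : s₁.realArr 3 = s.realArr 3 := hfr₁.realArr 3 (by decide)
  have e0 : s₁.natVar 0 = n := (hfr₁.natVar 0 (by decide)).trans hn
  have e2 : s₁.natVar 2 = r := (hfr₁.natVar 2 (by decide)).trans hr
  refine (Runs.forTo (N := n) (fun i s' =>
    (∃ v : Fin n, v ≠ r ∧ s'.realVar 0 = s.realArr 3 v) ∧
    ∀ v : Fin n, v.val < i → v ≠ r → s'.realVar 0 ≤ s.realArr 3 v) 20 e0 (by decide)
    (by decide) (by decide) ⟨⟨v₀, hv₀, hs₁⟩, by simp⟩ ?_).mono ?_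
  · rintro i s' hi hfr hx ⟨hI, hI'⟩
    have h3 : s'.realArr 3 = s.realArr 3 := (hfr.realArr 3 (by decide)).trans e3
    have h2 : s'.natVar 2 = r := (hfr.natVar 2 (by decide)).trans e2
    simp only [runs_branch, runs_setReal, runs_skip, BExp.Holds, NExp.eval, RExp.eval, BExp.cost,
      NExp.cost, RExp.cost, hx, h2, h3]
    refine ⟨fun hb => ⟨by norm_num, hI, fun v hv hvr => ?_⟩, fun hb =>
      ⟨fun hle => ⟨by norm_num, ⟨⟨i, hi⟩, ?_, by simp⟩, fun v hv hvr => ?_⟩,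
      fun hle => ⟨by norm_num, hI, fun v hv hvr => ?_⟩⟩⟩
    · refine hI' v ?_ hvr
      have : v.val ≠ r.val := by simpa [Fin.val_inj] using hvr
      omega
    · rintro rfl; simp at hb
    · simp only [Function.update_self]
      rcases Nat.lt_succ_iff_lt_or_eq.1 hv with hv | hv
      · exact hle.trans (hI' v hv hvr)
      · rw [hv]
    · rcases Nat.lt_succ_iff_lt_or_eq.1 hv with hv | hv
      · exact hI' v hv hvr
      · rw [hv]; exact (not_le.1 hle).le
  · rintro T s' hfr ⟨hT, ⟨v, hv, hI⟩, hI'⟩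
    refine ⟨by omega, ⟨v, hv, hI⟩, ?_⟩
    rintro _ ⟨u, hu, rfl⟩
    exact hI' u u.2 hu

/-- Compute an optimal `r`-acyclic orientation and its value. -/
def solveProg : Prog :=
  arcProg⨾clearProg⨾linkProg⨾growProg⨾orientProg⨾minProg

/-- The memory holds the arcs of `G`, an `r`-acyclic orientation of `G` given by marks of the
vertices, and its minimum weighted indegree, which is the largest possible. -/
structure Solved (L : EdgeList G m) (w : Sym2 (Fin n) → ℝ) (r : Fin n) (s : Store) : Prop where
  input : HasInput L w r s
  arcs_card : s.natVar 5 = m + m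
  arcs : IsArcs G w (m + m) (s.natArr 4) (s.natArr 5) (s.realArr 2)
  digraph : outDigraph L s = markDigraph G fun v => s.natArr 8 v
  rootedAcyclic : IsRootedAcyclic G r (markDigraph G fun v => s.natArr 8 v)
  least : IsLeast {x | ∃ v, v ≠ r ∧ x = inWeight (markDigraph G fun v => s.natArr 8 v) w v}
    (s.realVar 0)
  opt : ∀ x, Feasible G w r x → x ≤ s.realVar 0

theorem HasInput.of_frame {p : Prog} {s s' : Store} (h : HasInput L w r s) (hf : Frame p s s')
    (h0 : 0 ∉ p.natVars) (h1 : 1 ∉ p.natVars) (h2 : 2 ∉ p.natVars) (h0' : 0 ∉ p.natArrs)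
    (h1' : 1 ∉ p.natArrs) (h0'' : 0 ∉ p.realArrs) : HasInput L w r s' := by
  refine ⟨?_, ?_, ?_, ?_, ?_, ?_⟩
  · rw [hf.natVar 0 h0, h.size]
  · rw [hf.natVar 1 h1, h.edges]
  · rw [hf.natVar 2 h2, h.root]
  · rw [hf.natArr 0 h0']; exact h.src
  · rw [hf.natArr 1 h1']; exact h.dst
  · rw [hf.realArr 0 h0'']; exact h.weight

/-- Handshake lemma with all degrees at least 2. It allows costs linear in `n` to be absorbed into
those linear in `m`. -/
theorem IsTwoConnected.le_edges (hG : IsTwoConnected G) (hm : G.edgeSet.ncard = m) : n ≤ m := by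
  classical
  have hsum := G.sum_degrees_eq_twice_card_edges
  rw [← Set.ncard_coe_finset, SimpleGraph.coe_edgeFinset, hm] at hsum
  have h2 : ∑ _v : Fin n, 2 ≤ ∑ v, G.degree v :=
    Finset.sum_le_sum fun v _ => hG.two_le_degree
  simp at h2
  omega

theorem solveProg_runs {s : Store} (hG : IsTwoConnected G) (hw : ∀ e ∈ G.edgeSet, 0 ≤ w e)
    (h : HasInput L w r s) :
    Runs solveProg s fun T s' => T ≤ 700 * ((m - n + 1) * m) ∧ Solved L w r s' := by
  have hm := L.ncard_edgeSet
  have hn : 3 ≤ n := by simpa using hG.three_le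
  refine Runs.seq ((arcProg_runs h).mono ?_)
  rintro T₁ s₁ hfr₁ ⟨hT₁, hN₁, hA₁⟩
  have hin₁ := h.of_frame hfr₁ (by decide) (by decide) (by decide) (by decide) (by decide)
    (by decide)
  refine Runs.seq ((clearProg_runs hin₁.size).mono ?_)
  rintro T₂ s₂ hfr₂ ⟨hT₂, hz₂⟩
  have hin₂ := hin₁.of_frame hfr₂ (by decide) (by decide) (by decide) (by decide) (by decide)
    (by decide)
  have hA₂ : IsArcs G w (m + m) (s₂.natArr 4) (s₂.natArr 5) (s₂.realArr 2) := by
    rwa [hfr₂.natArr 4 (by decide), hfr₂.natArr 5 (by decide), hfr₂.realArr 2 (by decide)]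
  have hN₂ : s₂.natVar 5 = m + m := (hfr₂.natVar 5 (by decide)).trans hN₁
  refine Runs.seq ((linkProg_runs (n := n) hN₂ (fun v hv => (hz₂ v hv).1) fun e he => ?_).mono ?_)
  · obtain ⟨u, v, -, hu, -⟩ := hA₂.arc e he
    rw [hu]; exact u.2
  rintro T₃ s₃ hfr₃ ⟨hT₃, hl₃, hf₃⟩
  have hin₃ := hin₂.of_frame hfr₃ (by decide) (by decide) (by decide) (by decide) (by decide)
    (by decide)
  have h4 : s₃.natArr 4 = s₂.natArr 4 := hfr₃.natArr 4 (by decide)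
  have hA₃ : IsArcs G w (m + m) (s₃.natArr 4) (s₃.natArr 5) (s₃.realArr 2) := by
    rwa [h4, hfr₃.natArr 5 (by decide), hfr₃.realArr 2 (by decide)]
  have hN₃ : s₃.natVar 5 = m + m := (hfr₃.natVar 5 (by decide)).trans hN₂
  rw [← h4] at hl₃ hf₃
  refine Runs.seq ((growProg_runs hG hw hm hin₃.root hA₃ hl₃ hf₃
    (fun v hv => by rw [hfr₃.natArr 8 (by decide)]; exact (hz₂ v hv).2.1)
    (fun v hv => by rw [hfr₃.realArr 3 (by decide)]; exact (hz₂ v hv).2.2)).mono ?_)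
  rintro T₄ s₄ hfr₄ ⟨hT₄, hg₄, hall⟩
  have hin₄ := hin₃.of_frame hfr₄ (by decide) (by decide) (by decide) (by decide) (by decide)
    (by decide)
  have hinj : Function.Injective fun v : Fin n => s₄.natArr 8 v :=
    fun u v huv => hg₄.inj u v (hall u) huv
  have hr2 : s₄.natArr 8 r = 2 := by
    refine hg₄.root.resolve_left fun hc => ?_
    have := hg₄.lt r (hall r)
    have := hall r
    omega
  refine Runs.seq ((orientProg_runs hin₄ hinj).mono ?_)
  rintro T₅ s₅ hfr₅ ⟨hT₅, hD₅⟩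
  have hin₅ := hin₄.of_frame hfr₅ (by decide) (by decide) (by decide) (by decide) (by decide)
    (by decide)
  refine (minProg_runs hin₅.size (by omega) hin₅.root).mono ?_
  rintro T₆ s₆ hfr₆ ⟨hT₆, hK⟩
  have h8 : s₆.natArr 8 = s₄.natArr 8 := by
    rw [hfr₆.natArr 8 (by decide), hfr₅.natArr 8 (by decide)]
  -- With all vertices added, the condition in `acc_eq` reduces to adjacency and smaller rank, so
  -- the accumulated weights are the indegrees of the final orientation.
  have hacc : ∀ v : Fin n, s₅.realArr 3 v =
      inWeight (markDigraph G fun v => s₄.natArr 8 v) w v := by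
    intro v
    rw [hfr₅.realArr 3 (by decide), hg₄.acc_eq v]
    refine Finset.sum_congr rfl fun u _ => ?_
    have h1 := hall u
    have h2 := hall v
    have hiff : (G.Adj u v ∧ 2 ≤ s₄.natArr 8 u ∧
        (s₄.natArr 8 v < 2 ∨ s₄.natArr 8 u < s₄.natArr 8 v)) ↔
        (markDigraph G fun v => s₄.natArr 8 v).Adj u v :=
      and_congr_right fun _ => by
        show _ ↔ s₄.natArr 8 u < s₄.natArr 8 v
        omega
    by_cases hc : (markDigraph G fun v => s₄.natArr 8 v).Adj u v
    · exact (if_pos (hiff.2 hc)).trans (if_pos hc).symm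
    · exact (if_neg fun hh => hc (hiff.1 hh)).trans (if_neg hc).symm
  simp only [hacc] at hK
  refine ⟨?_, ⟨hin₅.of_frame hfr₆ (by decide) (by decide) (by decide) (by decide) (by decide)
    (by decide), ?_, ?_, ?_, ?_, ?_, ?_⟩⟩
  · have hnm := hG.le_edges hm
    have h1 : n * (40 * (m - n + 1) + 100) ≤ m * (140 * (m - n + 1)) :=
      Nat.mul_le_mul hnm (by omega)
    have h2 : 1 * m ≤ (m - n + 1) * m := Nat.mul_le_mul_right _ (by omega)
    have h3 : m * (140 * (m - n + 1)) = 140 * ((m - n + 1) * m) := by ring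
    omega
  · rw [hfr₆.natVar 5 (by decide), hfr₅.natVar 5 (by decide), hfr₄.natVar 5 (by decide), hN₃]
  · rwa [hfr₆.natArr 4 (by decide), hfr₅.natArr 4 (by decide), hfr₄.natArr 4 (by decide),
      hfr₆.natArr 5 (by decide), hfr₅.natArr 5 (by decide), hfr₄.natArr 5 (by decide),
      hfr₆.realArr 2 (by decide), hfr₅.realArr 2 (by decide), hfr₄.realArr 2 (by decide)]
  · rw [h8, ← hD₅]
    simp only [outDigraph, hfr₆.natArr 2 (by decide)]
  · rw [h8]
    refine isRootedAcyclic_markDigraph hinj (fun v hv => ?_) fun v => ?_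
    · obtain ⟨u, -, hu⟩ := hg₄.parent v hv (hall v)
      exact ⟨u, hu⟩
    · rw [hr2]; exact hall v
  · rwa [h8]
  · intro x hx
    -- The minimum is attained at some `v`, and no feasible value exceeds the weight that `v` had
    -- received when it was added.
    obtain ⟨v, hv, hv'⟩ := hK.1
    rw [hv', ← hacc, hfr₅.realArr 3 (by decide)]
    exact hg₄.opt x hx v hv (hall v)

end Solve

/-! ### Packing arborescences -/

section Pack

variable {n m : ℕ} {G : SimpleGraph (Fin n)} {w : Sym2 (Fin n) → ℝ} {r : Fin n}
  {L : EdgeList G m}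

/-- A packing of `cnt` arborescences (with parents `tr` and coefficients `lam`) together with the
remaining capacities `cap` of the arcs and the difference `rem` between `K` and its value. -/
structure PackState (D : Digraph (Fin n)) (w : Sym2 (Fin n) → ℝ) (r : Fin n) (N : ℕ)
    (tl hd : ℕ → ℕ) (K : ℝ) (tr : ℕ → ℕ) (lam cap : ℕ → ℝ) (cnt : ℕ) (rem : ℝ) : Prop where
  tree : ∀ j < cnt, ∀ v, v ≠ r → ∃ u : Fin n, D.Adj u v ∧ tr (j * n + v) = u
  pos : ∀ j < cnt, 0 < lam j
  cap_eq : ∀ e < N, ∀ u v : Fin n, tl e = u → hd e = v → D.Adj u v →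
    cap e = w s(u, v) - ∑ j ∈ Finset.range cnt, if tr (j * n + v) = u then lam j else 0
  cap_nonneg : ∀ e < N, 0 ≤ cap e
  rem_eq : rem = K - ∑ j ∈ Finset.range cnt, lam j
  rem_nonneg : 0 ≤ rem

variable {D : Digraph (Fin n)} {N cnt : ℕ} {tl hd tr tr' : ℕ → ℕ} {K rem : ℝ}
  {lam lam' cap cap' : ℕ → ℝ}

/-- Each tree packed so far uses one arc into `v`, so these arcs carry total load `K - rem`. This is
less than the indegree of `v`, hence not all of them can be saturated. -/
theorem PackState.exists_arc (h : PackState D w r N tl hd K tr lam cap cnt rem)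
    (hsurj : ∀ u v, D.Adj u v → ∃ e < N, tl e = u ∧ hd e = v)
    (hrem : 0 < rem) {v : Fin n} (hv : v ≠ r) (hK : K ≤ inWeight D w v) :
    ∃ e < N, hd e = v ∧ (∃ u : Fin n, tl e = u ∧ D.Adj u v) ∧ 0 < cap e := by
  classical
  by_contra! hcon
  have h1 : inWeight D w v ≤ ∑ u : Fin n, ∑ j ∈ Finset.range cnt,
      if tr (j * n + v) = u then lam j else 0 := by
    refine Finset.sum_le_sum fun u _ => ?_
    split_ifs with hu
    · obtain ⟨e, he, h1, h2⟩ := hsurj u v hu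
      have h3 := hcon e he h2 ⟨u, h1, hu⟩
      rw [h.cap_eq e he u v h1 h2 hu] at h3
      linarith
    · refine Finset.sum_nonneg fun j hj => ?_
      split_ifs
      · exact (h.pos j (Finset.mem_range.1 hj)).le
      · exact le_rfl
  rw [Finset.sum_comm] at h1
  have h2 : ∑ j ∈ Finset.range cnt, ∑ u : Fin n, (if tr (j * n + v) = u then lam j else 0) =
      ∑ j ∈ Finset.range cnt, lam j := by
    refine Finset.sum_congr rfl fun j hj => ?_
    obtain ⟨u, -, hu⟩ := h.tree j (Finset.mem_range.1 hj) v hv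
    simp [hu, Fin.val_inj]
  have := h.rem_eq
  linarith

/-- The arcs `par v` have different heads and are therefore distinct, so each of them loses `δ`
exactly once. Reserving a row of length `n` for each tree keeps the earlier trees intact. -/
theorem PackState.step {par : ℕ → ℕ} {δ : ℝ}
    (h : PackState D w r N tl hd K tr lam cap cnt rem)
    (hroot : ∀ u, ¬ D.Adj u r)
    (hinj : ∀ e < N, ∀ e' < N, tl e = tl e' → hd e = hd e' → e = e')
    (hpar : ∀ v : Fin n, v ≠ r → par v < N ∧ hd (par v) = v ∧
      ∃ u : Fin n, tl (par v) = u ∧ D.Adj u v)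
    (hδ : 0 < δ) (hδr : δ ≤ rem) (hδc : ∀ v : Fin n, v ≠ r → δ ≤ cap (par v))
    (htr : ∀ j < cnt * n, tr' j = tr j)
    (htr' : ∀ v : Fin n, v ≠ r → tr' (cnt * n + v) = tl (par v))
    (hlam : ∀ j < cnt, lam' j = lam j) (hlam' : lam' cnt = δ)
    (hcap : ∀ v : Fin n, v ≠ r → cap' (par v) = cap (par v) - δ)
    (hcap' : ∀ e, (∀ v : Fin n, v ≠ r → par v ≠ e) → cap' e = cap e) :
    PackState D w r N tl hd K tr' lam' cap' (cnt + 1) (rem - δ) := by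
  have hidx : ∀ j < cnt, ∀ v : Fin n, j * n + v < cnt * n := by
    intro j hj v
    calc j * n + v < j * n + n := by omega
      _ = (j + 1) * n := by ring
      _ ≤ cnt * n := Nat.mul_le_mul_right _ hj
  have hsum : ∑ j ∈ Finset.range cnt, lam' j = ∑ j ∈ Finset.range cnt, lam j :=
    Finset.sum_congr rfl fun j hj => hlam j (Finset.mem_range.1 hj)
  refine ⟨fun j hj v hv => ?_, fun j hj => ?_, fun e he u v hu hv huv => ?_, fun e he => ?_, ?_,
    by linarith⟩
  · rcases Nat.lt_succ_iff_lt_or_eq.1 hj with hj | rfl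
    · rw [htr _ (hidx j hj v)]; exact h.tree j hj v hv
    · obtain ⟨-, -, u, hu, huv⟩ := hpar v hv
      exact ⟨u, huv, by rw [htr' v hv, hu]⟩
  · rcases Nat.lt_succ_iff_lt_or_eq.1 hj with hj | rfl
    · rw [hlam j hj]; exact h.pos j hj
    · rwa [hlam']
  · have hvr : v ≠ r := by rintro rfl; exact hroot u huv
    obtain ⟨hp1, hp2, x, hx, hxv⟩ := hpar v hvr
    have hs : ∑ j ∈ Finset.range cnt, (if tr' (j * n + v) = u then lam' j else 0) =
        ∑ j ∈ Finset.range cnt, if tr (j * n + v) = u then lam j else 0 := by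
      refine Finset.sum_congr rfl fun j hj => ?_
      have hj := Finset.mem_range.1 hj
      rw [htr _ (hidx j hj v), hlam j hj]
    rw [Finset.sum_range_succ, hs, htr' v hvr, hlam', ← sub_sub, ← h.cap_eq e he u v hu hv huv]
    by_cases hh : tl (par v) = u
    · have : par v = e := hinj _ hp1 _ he (hh.trans hu.symm) (hp2.trans hv.symm)
      rw [if_pos hh, ← this, hcap v hvr]
    · rw [if_neg hh, sub_zero]
      refine hcap' e fun v' hv' hpe => hh ?_
      obtain ⟨-, hp2', -⟩ := hpar v' hv'
      rw [hpe] at hp2'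
      obtain rfl : v' = v := Fin.ext (hp2'.symm.trans hv)
      rw [hpe, hu]
  · by_cases hh : ∃ v : Fin n, v ≠ r ∧ par v = e
    · obtain ⟨v, hv, rfl⟩ := hh
      rw [hcap v hv]
      linarith [hδc v hv]
    · push Not at hh
      rw [hcap' e hh]
      exact h.cap_nonneg e he
  · rw [Finset.sum_range_succ, hsum, hlam', h.rem_eq]
    ring

/-- Choose for each vertex an entering arc of positive remaining capacity (natural array `10`). -/
def chooseProg : Prog :=
  .forTo 15 5
    (.branch (.both (.neg (.natLe (.get 8 (.get 5 (.var 15))) (.get 8 (.get 4 (.var 15)))))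
        (.neg (.realLe (.get 4 (.var 15)) .zero)))
      (.putNat 10 (.get 5 (.var 15)) (.var 15)) .skip)

theorem chooseProg_runs {s : Store} (hN : s.natVar 5 = N) :
    Runs chooseProg s fun T s' => T ≤ 40 * N + 10 ∧
      ∀ v : ℕ, (∃ e < N, s.natArr 5 e = v ∧
          s.natArr 8 (s.natArr 4 e) < s.natArr 8 (s.natArr 5 e) ∧ 0 < s.realArr 4 e) →
        s'.natArr 10 v < N ∧ s.natArr 5 (s'.natArr 10 v) = v ∧
          s.natArr 8 (s.natArr 4 (s'.natArr 10 v)) < s.natArr 8 (s.natArr 5 (s'.natArr 10 v)) ∧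
          0 < s.realArr 4 (s'.natArr 10 v) := by
  refine (Runs.forTo (N := N) (fun i s' => ∀ v : ℕ, (∃ e < i, s.natArr 5 e = v ∧
          s.natArr 8 (s.natArr 4 e) < s.natArr 8 (s.natArr 5 e) ∧ 0 < s.realArr 4 e) →
        s'.natArr 10 v < N ∧ s.natArr 5 (s'.natArr 10 v) = v ∧
          s.natArr 8 (s.natArr 4 (s'.natArr 10 v)) < s.natArr 8 (s.natArr 5 (s'.natArr 10 v)) ∧
          0 < s.realArr 4 (s'.natArr 10 v)) 25 hN (by decide)
    (by decide) (by decide) (by simp) ?_).mono ?_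
  · intro i s' hi hfr hx hI
    have h4 := hfr.natArr 4 (by decide)
    have h5 := hfr.natArr 5 (by decide)
    have h8 := hfr.natArr 8 (by decide)
    have hc := hfr.realArr 4 (by decide)
    simp only [runs_branch, runs_putNat, runs_skip, BExp.Holds, NExp.eval, RExp.eval, BExp.cost,
      NExp.cost, RExp.cost, hx, h4, h5, h8, hc, not_le]
    refine ⟨fun hb => ⟨by norm_num, fun v => ?_⟩, fun hb => ⟨by norm_num, fun v => ?_⟩⟩
    · rintro ⟨e, he, hv, hlt, hpos⟩
      by_cases hvi : v = s.natArr 5 i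
      · subst hvi
        simpa [hi] using hb
      · have hei : e ≠ i := by rintro rfl; exact hvi hv.symm
        simpa [hvi] using hI v ⟨e, by omega, hv, hlt, hpos⟩
    · rintro ⟨e, he, hv, hlt, hpos⟩
      have hei : e ≠ i := by rintro rfl; exact hb ⟨hlt, hpos⟩
      exact hI v ⟨e, by omega, hv, hlt, hpos⟩
  · rintro T s' - ⟨hT, hI⟩
    exact ⟨by omega, hI⟩

/-- The coefficient (real register `2`) of the next arborescence. -/
def deltaProg : Prog :=
  .setReal 2 (.var 1)⨾
  .forTo 16 0
    (.branch (.both (.natLe (.var 16) (.var 2)) (.natLe (.var 2) (.var 16))) .skip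
      (.branch (.realLe (.get 4 (.get 10 (.var 16))) (.var 2))
        (.setReal 2 (.get 4 (.get 10 (.var 16)))) .skip))

/-- The final alternative ensures progress: the coefficient equals either the value still missing or
the remaining capacity of a chosen arc, which is then used up. -/
theorem deltaProg_runs {s : Store} (hn : s.natVar 0 = n) (hr : s.natVar 2 = r) :
    Runs deltaProg s fun T s' => T ≤ 40 * n + 20 ∧ s'.realVar 2 ≤ s.realVar 1 ∧
      (∀ v : Fin n, v ≠ r → s'.realVar 2 ≤ s.realArr 4 (s.natArr 10 v)) ∧
      (s'.realVar 2 = s.realVar 1 ∨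
        ∃ v : Fin n, v ≠ r ∧ s'.realVar 2 = s.realArr 4 (s.natArr 10 v)) := by
  simp only [deltaProg, runs_seq, runs_setReal]
  refine (Runs.forTo (N := n) (fun i s' => s'.realVar 2 ≤ s.realVar 1 ∧
      (∀ v : Fin n, v.val < i → v ≠ r → s'.realVar 2 ≤ s.realArr 4 (s.natArr 10 v)) ∧
      (s'.realVar 2 = s.realVar 1 ∨
        ∃ v : Fin n, v ≠ r ∧ s'.realVar 2 = s.realArr 4 (s.natArr 10 v))) 22 (by simpa using hn)
    (by decide) (by decide) (by decide) (by simp) ?_).mono ?_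
  · rintro i s' hi hfr hx ⟨hI, hI', hI''⟩
    have h4 : s'.realArr 4 = s.realArr 4 := hfr.realArr 4 (by decide)
    have h10 : s'.natArr 10 = s.natArr 10 := hfr.natArr 10 (by decide)
    have h2 : s'.natVar 2 = r := (hfr.natVar 2 (by decide)).trans hr
    simp only [runs_branch, runs_setReal, runs_skip, BExp.Holds, NExp.eval, RExp.eval, BExp.cost,
      NExp.cost, RExp.cost, hx, h2, h4, h10]
    refine ⟨fun hb => ⟨by norm_num, hI, fun v hv hvr => ?_, hI''⟩, fun hb =>
      ⟨fun hle => ⟨by norm_num, ?_, fun v hv hvr => ?_, .inr ⟨⟨i, hi⟩, ?_, by simp⟩⟩,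
      fun hle => ⟨by norm_num, hI, fun v hv hvr => ?_, hI''⟩⟩⟩
    · refine hI' v ?_ hvr
      have : v.val ≠ r.val := by simpa [Fin.val_inj] using hvr
      omega
    · simpa using hle.trans hI
    · simp only [Function.update_self]
      rcases Nat.lt_succ_iff_lt_or_eq.1 hv with hv | hv
      · exact hle.trans (hI' v hv hvr)
      · rw [hv]
    · rintro rfl; simp at hb
    · rcases Nat.lt_succ_iff_lt_or_eq.1 hv with hv | hv
      · exact hI' v hv hvr
      · rw [hv]; exact (not_le.1 hle).le
  · rintro T s' hfr ⟨hT, h1, h2, h3⟩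
    exact ⟨by simp; omega, h1, fun v hv => h2 v v.2 hv, h3⟩

/-- Reduce the capacities of the chosen arcs and write down their tails, as the parents in the
next arborescence. -/
def emitProg : Prog :=
  .forTo 16 0
    (.branch (.both (.natLe (.var 16) (.var 2)) (.natLe (.var 2) (.var 16))) .skip
      (.putReal 4 (.get 10 (.var 16)) (.minus (.get 4 (.get 10 (.var 16))) (.var 2))⨾
      .putNat 3 (.plus (.var 17) (.var 16)) (.get 4 (.get 10 (.var 16)))))

theorem emitProg_runs {s : Store} (hn : s.natVar 0 = n) (hr : s.natVar 2 = r)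
    (hpar : ∀ v : Fin n, v ≠ r → s.natArr 5 (s.natArr 10 v) = v) :
    Runs emitProg s fun T s' => T ≤ 50 * n + 20 ∧
      (∀ j < s.natVar 17, s'.natArr 3 j = s.natArr 3 j) ∧
      (∀ v : Fin n, v ≠ r → s'.natArr 3 (s.natVar 17 + v) = s.natArr 4 (s.natArr 10 v)) ∧
      (∀ v : Fin n, v ≠ r →
        s'.realArr 4 (s.natArr 10 v) = s.realArr 4 (s.natArr 10 v) - s.realVar 2) ∧
      (∀ e, (∀ v : Fin n, v ≠ r → s.natArr 10 v ≠ e) → s'.realArr 4 e = s.realArr 4 e) := by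
  refine (Runs.forTo (N := n) (fun i s' =>
      (∀ j < s.natVar 17, s'.natArr 3 j = s.natArr 3 j) ∧
      (∀ v : Fin n, v.val < i → v ≠ r →
        s'.natArr 3 (s.natVar 17 + v) = s.natArr 4 (s.natArr 10 v)) ∧
      (∀ v : Fin n, v.val < i → v ≠ r →
        s'.realArr 4 (s.natArr 10 v) = s.realArr 4 (s.natArr 10 v) - s.realVar 2) ∧
      (∀ e, (∀ v : Fin n, v.val < i → v ≠ r → s.natArr 10 v ≠ e) →
        s'.realArr 4 e = s.realArr 4 e)) 30 hn (by decide)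
    (by decide) (by decide) (by simp) ?_).mono ?_
  · rintro i s' hi hfr hx ⟨hI1, hI2, hI3, hI4⟩
    have h4 : s'.natArr 4 = s.natArr 4 := hfr.natArr 4 (by decide)
    have h10 : s'.natArr 10 = s.natArr 10 := hfr.natArr 10 (by decide)
    have h2 : s'.natVar 2 = r := (hfr.natVar 2 (by decide)).trans hr
    have h17 : s'.natVar 17 = s.natVar 17 := hfr.natVar 17 (by decide)
    have hd : s'.realVar 2 = s.realVar 2 := hfr.realVar 2 (by decide)
    simp only [runs_branch, runs_seq, runs_putNat, runs_putReal, runs_skip, BExp.Holds, NExp.eval,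
      RExp.eval, BExp.cost, NExp.cost, RExp.cost, hx, h2, h4, h10, h17, hd, Function.update_self]
    refine ⟨fun hb => ⟨by norm_num, hI1, fun v hv hvr => ?_, fun v hv hvr => ?_, fun e he => ?_⟩,
      fun hb => ⟨by norm_num, fun j hj => ?_, fun v hv hvr => ?_, fun v hv hvr => ?_,
        fun e he => ?_⟩⟩
    · have : v.val ≠ r.val := by simpa [Fin.val_inj] using hvr
      exact hI2 v (by omega) hvr
    · have : v.val ≠ r.val := by simpa [Fin.val_inj] using hvr
      exact hI3 v (by omega) hvr
    · exact hI4 e fun v hv hvr => he v (by omega) hvr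
    · rw [Function.update_of_ne (by omega)]
      exact hI1 j hj
    · rcases Nat.lt_succ_iff_lt_or_eq.1 hv with hv | hv
      · rw [Function.update_of_ne (by omega)]
        exact hI2 v hv hvr
      · rw [hv, Function.update_self]
    · have hir : (⟨i, hi⟩ : Fin n) ≠ r := by rintro rfl; simp at hb
      have hpi := hpar ⟨i, hi⟩ hir
      simp only [] at hpi
      rcases Nat.lt_succ_iff_lt_or_eq.1 hv with hv | hv
      · rw [Function.update_of_ne, hI3 v hv hvr]
        intro hh
        have := hpar v hvr
        rw [hh, hpi] at this
        omega
      -- Arcs chosen for other vertices have other heads, so the capacity of this arc has not been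
      -- changed in earlier rounds.
      · rw [hv, Function.update_self, hI4]
        intro v' hv' hvr' hh
        have := hpar v' hvr'
        rw [hh, hpi] at this
        omega
    · have hir : (⟨i, hi⟩ : Fin n) ≠ r := by rintro rfl; simp at hb
      rw [Function.update_of_ne (Ne.symm (he ⟨i, hi⟩ (by simp) hir))]
      exact hI4 e fun v hv hvr => he v (by omega) hvr
  · rintro T s' hfr ⟨hT, h1, h2, h3, h4⟩
    exact ⟨by omega, h1, fun v hv => h2 v v.2 hv, fun v hv => h3 v v.2 hv,
      fun e he => h4 e fun v _ hv => he v hv⟩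

/-- Record the coefficient of the arborescence just written. -/
def recordProg : Prog :=
  .putReal 1 (.var 3) (.var 2)⨾
  .setNat 3 (.plus (.var 3) (.lit 1))⨾
  .setNat 17 (.plus (.var 17) (.var 0))⨾
  .setReal 1 (.minus (.var 1) (.var 2))

theorem recordProg_runs {s : Store} :
    Runs recordProg s fun T s' => T ≤ 20 ∧
      s'.realArr 1 = Function.update (s.realArr 1) (s.natVar 3) (s.realVar 2) ∧
      s'.natVar 3 = s.natVar 3 + 1 ∧ s'.natVar 17 = s.natVar 17 + s.natVar 0 ∧
      s'.realVar 1 = s.realVar 1 - s.realVar 2 := by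
  simp [recordProg]

/-- Copy the weights of the arcs to their capacities. -/
def capProg : Prog := .forTo 15 5 (.putReal 4 (.var 15) (.get 2 (.var 15)))

theorem capProg_runs {s : Store} (hN : s.natVar 5 = N) :
    Runs capProg s fun T s' => T ≤ 20 * N + 20 ∧ ∀ e < N, s'.realArr 4 e = s.realArr 2 e := by
  refine (Runs.forTo (N := N) (fun i s' => ∀ e < i, s'.realArr 4 e = s.realArr 2 e) 4 hN
    (by decide) (by decide) (by decide) (by simp) ?_).mono ?_
  · rintro i s' hi hfr hx hI
    have h2 : s'.realArr 2 = s.realArr 2 := hfr.realArr 2 (by decide)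
    simp only [runs_putReal, NExp.eval, RExp.eval, NExp.cost, RExp.cost, hx, h2,
      Function.update_self]
    refine ⟨by norm_num, fun e he => ?_⟩
    rcases Nat.lt_succ_iff_lt_or_eq.1 he with he | rfl
    · rw [Function.update_of_ne (by omega)]
      exact hI e he
    · rw [Function.update_self]
  · rintro T s' - ⟨hT, hI⟩
    exact ⟨by omega, hI⟩

/-- Pack arborescences as long as the value of the packing is less than the real register `0`. -/
def packProg : Prog :=
  capProg⨾.setNat 3 (.lit 0)⨾.setNat 17 (.lit 0)⨾.setReal 1 (.var 0)⨾
  .loop (.neg (.realLe (.var 1) .zero)) (chooseProg⨾deltaProg⨾emitProg⨾recordProg)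

theorem Solved.of_frame {p : Prog} {s s' : Store} (h : Solved L w r s) (hf : Frame p s s')
    (hv : ∀ x ∈ [0, 1, 2, 5], x ∉ p.natVars) (ha : ∀ a ∈ [0, 1, 2, 4, 5, 8], a ∉ p.natArrs)
    (hx : 0 ∉ p.realVars) (hw : ∀ a ∈ [0, 2], a ∉ p.realArrs) : Solved L w r s' := by
  have h8 := hf.natArr 8 (ha 8 (by simp))
  refine ⟨h.input.of_frame hf (hv _ (by simp)) (hv _ (by simp)) (hv _ (by simp)) (ha _ (by simp))
    (ha _ (by simp)) (hw _ (by simp)), ?_, ?_, ?_, ?_, ?_, ?_⟩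
  · rw [hf.natVar 5 (hv _ (by simp)), h.arcs_card]
  · rw [hf.natArr 4 (ha _ (by simp)), hf.natArr 5 (ha _ (by simp)),
      hf.realArr 2 (hw _ (by simp))]
    exact h.arcs
  · rw [h8, ← h.digraph]
    simp only [outDigraph, hf.natArr 2 (ha _ (by simp))]
  · rw [h8]; exact h.rootedAcyclic
  · rw [h8, hf.realVar 0 hx]; exact h.least
  · rw [hf.realVar 0 hx]; exact h.opt

theorem Solved.value_nonneg {s : Store} (hw : ∀ e ∈ G.edgeSet, 0 ≤ w e) (h : Solved L w r s) :
    0 ≤ s.realVar 0 := by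
  obtain ⟨v, hv, hh⟩ := h.least.1
  rw [hh]
  refine Finset.sum_nonneg fun u _ => ?_
  split_ifs with hu
  · exact hw _ hu.1
  · exact le_rfl

/-- The potential counts the arcs of positive remaining capacity, plus one while value is missing.
No arc regains capacity and each round lowers this count, which bounds the number of rounds by `2 *
m + 1`. -/
theorem packProg_loop_runs {s : Store} (h : Solved L w r s) (h17 : s.natVar 17 = s.natVar 3 * n)
    (hp : PackState (markDigraph G fun v => s.natArr 8 v) w r (m + m) (s.natArr 4) (s.natArr 5)
      (s.realVar 0) (s.natArr 3) (s.realArr 1) (s.realArr 4) (s.natVar 3) (s.realVar 1)) :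
    Runs (.loop (.neg (.realLe (.var 1) .zero)) (chooseProg⨾deltaProg⨾emitProg⨾recordProg)) s
      fun T s' => T ≤ (m + m + 1) * (100 * (m + n) + 100) + 10 ∧
      PackState (markDigraph G fun v => s.natArr 8 v) w r (m + m) (s.natArr 4) (s.natArr 5)
        (s.realVar 0) (s'.natArr 3) (s'.realArr 1) (s'.realArr 4) (s'.natVar 3) 0 := by
  classical
  set D := markDigraph G fun v => s.natArr 8 v with hDdef
  refine (Runs.loop (fun k s' =>
      k = (((Finset.range (m + m)).filter fun e => 0 < s'.realArr 4 e).card +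
        if 0 < s'.realVar 1 then 1 else 0) * (100 * (m + n) + 100) ∧
      s'.natVar 17 = s'.natVar 3 * n ∧
      PackState D w r (m + m) (s.natArr 4) (s.natArr 5) (s.realVar 0) (s'.natArr 3) (s'.realArr 1)
        (s'.realArr 4) (s'.natVar 3) (s'.realVar 1)) ⟨rfl, h17, hp⟩ ?_).mono ?_
  · rintro k s₁ hfr ⟨rfl, h17₁, hp₁⟩ hb
    have hrem : 0 < s₁.realVar 1 := by simpa using hb
    have h₁ : Solved L w r s₁ :=
      h.of_frame hfr (by decide) (by decide) (by decide) (by decide)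
    have e4 : s₁.natArr 4 = s.natArr 4 := hfr.natArr 4 (by decide)
    have e5 : s₁.natArr 5 = s.natArr 5 := hfr.natArr 5 (by decide)
    have e8 : s₁.natArr 8 = s.natArr 8 := hfr.natArr 8 (by decide)
    have hDadj : ∀ e < m + m, ∀ v : Fin n, s.natArr 5 e = v →
        (s.natArr 8 (s.natArr 4 e) < s.natArr 8 (s.natArr 5 e) ↔
          ∃ u : Fin n, s.natArr 4 e = u ∧ D.Adj u v) := by
      intro e he v hv
      obtain ⟨u, v', huv, h1, h2, -⟩ := h.arcs.arc e he
      obtain rfl : v' = v := Fin.ext (h2.symm.trans hv)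
      rw [h1, h2]
      constructor
      · exact fun hlt => ⟨u, rfl, huv, hlt⟩
      · rintro ⟨u', hu', hadj⟩
        obtain rfl : u = u' := Fin.ext hu'
        exact hadj.2
    have hroot : ∀ u, ¬ D.Adj u r := (h.rootedAcyclic.source_iff r).2 rfl
    refine Runs.seq ((chooseProg_runs h₁.arcs_card).mono ?_)
    rintro T₁ s₂ hfr₂ ⟨hT₁, hch⟩
    rw [e4, e5, e8] at hch
    have h₂ : Solved L w r s₂ :=
      h₁.of_frame hfr₂ (by decide) (by decide) (by decide) (by decide)
    have f4 : s₂.realArr 4 = s₁.realArr 4 := hfr₂.realArr 4 (by decide)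
    -- `PackState.exists_arc` applies because `K` is the minimum indegree, so the search finds an
    -- arc for every vertex other than the root.
    have hpar : ∀ v : Fin n, v ≠ r → s₂.natArr 10 v < m + m ∧
        s.natArr 5 (s₂.natArr 10 v) = v ∧
        (∃ u : Fin n, s.natArr 4 (s₂.natArr 10 v) = u ∧ D.Adj u v) ∧
        0 < s₁.realArr 4 (s₂.natArr 10 v) := by
      intro v hv
      obtain ⟨e, he, h1, h2, h3⟩ := hp₁.exists_arc
        (fun u v huv => h.arcs.surj u v huv.1) hrem hv (h.least.2 ⟨v, hv, rfl⟩)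
      obtain ⟨g1, g2, g3, g4⟩ := hch v ⟨e, he, h1, (hDadj e he v h1).2 h2, h3⟩
      exact ⟨g1, g2, (hDadj _ g1 v g2).1 g3, g4⟩
    refine Runs.seq ((deltaProg_runs h₂.input.size h₂.input.root).mono ?_)
    rintro T₂ s₃ hfr₃ ⟨hT₂, hd1, hd2, hd3⟩
    have h₃ : Solved L w r s₃ :=
      h₂.of_frame hfr₃ (by decide) (by decide) (by decide) (by decide)
    rw [hfr₂.realVar 1 (by decide)] at hd1 hd3
    rw [f4] at hd2 hd3
    have g10 : s₃.natArr 10 = s₂.natArr 10 := hfr₃.natArr 10 (by decide)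
    have g4 : s₃.realArr 4 = s₁.realArr 4 := (hfr₃.realArr 4 (by decide)).trans f4
    have g5 : s₃.natArr 5 = s.natArr 5 := by
      rw [hfr₃.natArr 5 (by decide), hfr₂.natArr 5 (by decide), e5]
    have gt : s₃.natArr 4 = s.natArr 4 := by
      rw [hfr₃.natArr 4 (by decide), hfr₂.natArr 4 (by decide), e4]
    have g17 : s₃.natVar 17 = s₁.natVar 3 * n := by
      rw [hfr₃.natVar 17 (by decide), hfr₂.natVar 17 (by decide), h17₁]
    have g3 : s₃.natArr 3 = s₁.natArr 3 := by
      rw [hfr₃.natArr 3 (by decide), hfr₂.natArr 3 (by decide)]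
    set δ := s₃.realVar 2 with hδ
    have hδpos : 0 < δ := by
      rcases hd3 with hd | ⟨v, hv, hd⟩
      · rw [hd]; exact hrem
      · rw [hd]; exact (hpar v hv).2.2.2
    refine Runs.seq ((emitProg_runs h₃.input.size h₃.input.root
      (fun v hv => by rw [g5, g10]; exact (hpar v hv).2.1)).mono ?_)
    rintro T₃ s₄ hfr₄ ⟨hT₃, hm1, hm2, hm3, hm4⟩
    rw [g17, g3] at hm1
    rw [g17, gt, g10] at hm2
    rw [g4, g10, ← hδ] at hm3
    rw [g4, g10] at hm4
    refine recordProg_runs.mono ?_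
    rintro T₄ s₅ hfr₅ ⟨hT₄, hr1, hr2, hr3, hr4⟩
    rw [hfr₄.realVar 2 (by decide), ← hδ] at hr1 hr4
    rw [hfr₄.realArr 1 (by decide), hfr₃.realArr 1 (by decide), hfr₂.realArr 1 (by decide),
      hfr₄.natVar 3 (by decide), hfr₃.natVar 3 (by decide), hfr₂.natVar 3 (by decide)] at hr1
    rw [hfr₄.natVar 3 (by decide), hfr₃.natVar 3 (by decide), hfr₂.natVar 3 (by decide)] at hr2
    rw [hfr₄.natVar 17 (by decide), g17, hfr₄.natVar 0 (by decide), h₃.input.size] at hr3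
    rw [hfr₄.realVar 1 (by decide), hfr₃.realVar 1 (by decide), hfr₂.realVar 1 (by decide)] at hr4
    have i3 : s₅.natArr 3 = s₄.natArr 3 := hfr₅.natArr 3 (by decide)
    have i4 : s₅.realArr 4 = s₄.realArr 4 := hfr₅.realArr 4 (by decide)
    have hp₅ : PackState D w r (m + m) (s.natArr 4) (s.natArr 5) (s.realVar 0) (s₅.natArr 3)
        (s₅.realArr 1) (s₅.realArr 4) (s₅.natVar 3) (s₅.realVar 1) := by
      rw [hr2, hr4]
      refine hp₁.step (par := s₂.natArr 10) hroot h.arcs.inj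
        (fun v hv => ⟨(hpar v hv).1, (hpar v hv).2.1, (hpar v hv).2.2.1⟩) hδpos hd1 hd2
        (by rwa [i3]) (by rwa [i3]) (fun j hj => ?_) ?_ (by rwa [i4]) (by rwa [i4])
      · rw [hr1, Function.update_of_ne (by omega)]
      · rw [hr1, Function.update_self]
    refine ⟨_, ⟨rfl, ?_, hp₅⟩, ?_⟩
    · rw [hr3, hr2]; ring
    have hsub : ((Finset.range (m + m)).filter fun e => 0 < s₅.realArr 4 e) ⊆
        (Finset.range (m + m)).filter fun e => 0 < s₁.realArr 4 e := by
      intro e he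
      simp only [Finset.mem_filter] at he ⊢
      refine ⟨he.1, ?_⟩
      by_cases hh : ∃ v : Fin n, v ≠ r ∧ s₂.natArr 10 v = e
      · obtain ⟨v, hv, rfl⟩ := hh
        exact (hpar v hv).2.2.2
      · push Not at hh
        rw [← hm4 e hh, ← i4]
        exact he.2
    -- If `δ` equals the missing value, the extra unit disappears; otherwise the arc whose capacity
    -- determined `δ` drops to capacity 0.
    have hlt : ((Finset.range (m + m)).filter fun e => 0 < s₅.realArr 4 e).card +
        (if 0 < s₅.realVar 1 then 1 else 0) + 1 ≤
        ((Finset.range (m + m)).filter fun e => 0 < s₁.realArr 4 e).card + 1 := by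
      rcases hd3 with hd | ⟨v, hv, hd⟩
      · rw [if_neg (by rw [hr4, hd]; simp)]
        have := Finset.card_le_card hsub
        omega
      · have hss : ((Finset.range (m + m)).filter fun e => 0 < s₅.realArr 4 e) ⊂
            (Finset.range (m + m)).filter fun e => 0 < s₁.realArr 4 e := by
          refine (Finset.ssubset_iff_of_subset hsub).2 ⟨s₂.natArr 10 v, ?_, ?_⟩
          · simp only [Finset.mem_filter, Finset.mem_range]
            exact ⟨(hpar v hv).1, (hpar v hv).2.2.2⟩
          · simp only [Finset.mem_filter, not_and]
            intro _
            rw [i4, hm3 v hv, ← hd]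
            simp
        have := Finset.card_lt_card hss
        split_ifs <;> omega
    rw [if_pos hrem]
    have hmul := Nat.mul_le_mul_right (100 * (m + n) + 100) hlt
    rw [add_mul _ 1, one_mul] at hmul
    simp only [BExp.cost, RExp.cost]
    omega
  · rintro T s' hfr ⟨hT, ⟨k', -, -, -, hp'⟩, hb⟩
    have h0 : s'.realVar 1 = 0 :=
      le_antisymm (by simpa using hb) hp'.rem_nonneg
    rw [h0] at hp'
    refine ⟨?_, hp'⟩
    have h1 : ((Finset.range (m + m)).filter fun e => 0 < s.realArr 4 e).card +
        (if 0 < s.realVar 1 then 1 else 0) ≤ m + m + 1 := by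
      have := Finset.card_filter_le (Finset.range (m + m)) fun e => 0 < s.realArr 4 e
      rw [Finset.card_range] at this
      split_ifs <;> omega
    have h2 := Nat.mul_le_mul_right (100 * (m + n) + 100) h1
    simp only [BExp.cost, RExp.cost] at hT
    omega

theorem packProg_runs {s : Store} (hw : ∀ e ∈ G.edgeSet, 0 ≤ w e) (h : Solved L w r s) :
    Runs packProg s fun T s' => T ≤ (m + m + 1) * (100 * (m + n) + 100) + 40 * m + 50 ∧
      PackState (markDigraph G fun v => s.natArr 8 v) w r (m + m) (s.natArr 4) (s.natArr 5)
        (s.realVar 0) (s'.natArr 3) (s'.realArr 1) (s'.realArr 4) (s'.natVar 3) 0 := by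
  refine Runs.seq ((capProg_runs h.arcs_card).mono ?_)
  rintro T₁ s₁ hfr₁ ⟨hT₁, hc⟩
  have h₁ : Solved L w r s₁ := h.of_frame hfr₁ (by decide) (by decide) (by decide) (by decide)
  simp only [runs_seq, runs_setNat, runs_setReal, NExp.eval, RExp.eval, NExp.cost, RExp.cost]
  have hK := h₁.value_nonneg hw
  have f0 : s₁.realVar 0 = s.realVar 0 := hfr₁.realVar 0 (by decide)
  have f4 : s₁.natArr 4 = s.natArr 4 := hfr₁.natArr 4 (by decide)
  have f5 : s₁.natArr 5 = s.natArr 5 := hfr₁.natArr 5 (by decide)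
  have f8 : s₁.natArr 8 = s.natArr 8 := hfr₁.natArr 8 (by decide)
  have f2 : s₁.realArr 2 = s.realArr 2 := hfr₁.realArr 2 (by decide)
  refine (packProg_loop_runs (L := L) (w := w) (r := r) ?_ ?_ ?_).mono ?_
  · have hi := h₁.input
    exact ⟨⟨by simp [hi.size], by simp [hi.edges], by simp [hi.root], hi.src, hi.dst, hi.weight⟩,
      by simp [h₁.arcs_card], h₁.arcs, h₁.digraph, h₁.rootedAcyclic, h₁.least, h₁.opt⟩
  · simp
  · simp only [Function.update_self, ne_eq, not_false_eq_true, Function.update_of_ne,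
      Nat.reduceEqDiff]
    refine ⟨by simp, by simp, fun e he u v hu hv huv => ?_, fun e he => ?_, ?_, ?_⟩
    · obtain ⟨u', v', -, h1, h2, h3⟩ := h₁.arcs.arc e he
      obtain rfl : u' = u := Fin.ext (h1.symm.trans hu)
      obtain rfl : v' = v := Fin.ext (h2.symm.trans hv)
      simp [hc e he, ← h3, f2]
    · obtain ⟨u, v, huv, h1, h2, h3⟩ := h₁.arcs.arc e he
      rw [hc e he, ← f2, h3]
      exact hw _ huv
    · simp
    · simpa using hK
  · rintro T s' - ⟨hT, hp⟩
    refine ⟨by omega, ?_⟩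
    simpa [f0, f4, f5, f8] using hp

-- Parents have smaller marks, so strong induction on the mark shows that every vertex is reached
-- from `r`. The capacity condition is the nonnegativity of the remaining capacities, and the value
-- is `K` because the remainder is 0.
open Classical in
theorem PackState.isPacking {s : Store} (h : PackState (markDigraph G fun v => s.natArr 8 v) w r N
      tl hd K (s.natArr 3) (s.realArr 1) cap (s.natVar 3) 0)
    (hsurj : ∀ u v, G.Adj u v → ∃ e < N, tl e = u ∧ hd e = v)
    (hroot : ∀ v, (markDigraph G fun v => s.natArr 8 v).Adj v r → False) :
    IsPacking (markDigraph G fun v => s.natArr 8 v) w r (outCoeff s) (outTree s r) ∧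
      ∑ j, outCoeff s j = K := by
  have hpar : ∀ (j : Fin (s.natVar 3)) (v : Fin n), v ≠ r → ∃ u,
      (markDigraph G fun v => s.natArr 8 v).Adj u v ∧ s.natArr 3 (j * n + v) = u :=
    fun j v hv => h.tree j j.2 v hv
  refine ⟨⟨fun j => h.pos j j.2, fun j => ⟨?_, ?_, ?_, ?_⟩, ?_⟩, ?_⟩
  · rintro u v ⟨hv, huv⟩
    obtain ⟨u', hadj, hu'⟩ := hpar j v hv
    obtain rfl : u' = u := Fin.ext (hu'.symm.trans huv)
    exact hadj
  · rintro u ⟨hu, -⟩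
    exact hu rfl
  · intro v hv
    obtain ⟨u, -, hu⟩ := hpar j v hv
    exact ⟨u, ⟨hv, hu⟩, fun y hy => Fin.ext (hy.2.symm.trans hu)⟩
  · have : ∀ (k : ℕ) (v : Fin n), s.natArr 8 v = k →
        Relation.ReflTransGen (outTree s r j).Adj r v := by
      intro k
      induction k using Nat.strong_induction_on with
      | _ k ih =>
        intro v hk
        by_cases hv : v = r
        · rw [hv]
        · obtain ⟨u, hadj, hu⟩ := hpar j v hv
          exact (ih _ (hk ▸ hadj.2) u rfl).tail ⟨hv, hu⟩
    exact fun v => this _ v rfl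
  · intro u v huv
    obtain ⟨e, he, h1, h2⟩ := hsurj u v huv.1
    have h3 := h.cap_nonneg e he
    rw [h.cap_eq e he u v h1 h2 huv] at h3
    have hv : v ≠ r := by rintro rfl; exact hroot u huv
    rw [Finset.sum_range] at h3
    simpa [outTree, hv, outCoeff] using h3
  · have := h.rem_eq
    rw [Finset.sum_range] at this
    simp only [outCoeff]
    linarith

end Pack

/-! ### The algorithms -/

section Algorithms

variable {n m : ℕ} {G : SimpleGraph (Fin n)} {w : Sym2 (Fin n) → ℝ} {r : Fin n}
  {L : EdgeList G m}

theorem packProg_isPacking {s : Store} (hw : ∀ e ∈ G.edgeSet, 0 ≤ w e) (h : Solved L w r s) :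
    Runs packProg s fun T s' => T ≤ (m + m + 1) * (100 * (m + n) + 100) + 40 * m + 50 ∧
      Solved L w r s' ∧ IsPacking (outDigraph L s') w r (outCoeff s') (outTree s' r) ∧
      ∑ j, outCoeff s' j = s'.realVar 0 ∧ outDigraph L s' = outDigraph L s ∧
      s'.realVar 0 = s.realVar 0 := by
  refine (packProg_runs hw h).mono ?_
  rintro T s' hfr ⟨hT, hp⟩
  have h' : Solved L w r s' := h.of_frame hfr (by decide) (by decide) (by decide) (by decide)
  have h8 : s'.natArr 8 = s.natArr 8 := hfr.natArr 8 (by decide)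
  have h0 : s'.realVar 0 = s.realVar 0 := hfr.realVar 0 (by decide)
  rw [← h8, ← h0] at hp
  have hpack := hp.isPacking h.arcs.surj ((h'.rootedAcyclic.source_iff r).2 rfl)
  rw [← h'.digraph] at hpack
  exact ⟨hT, h', hpack.1, hpack.2, by rw [h'.digraph, h.digraph, h8], h0⟩

/-- The packing that certifies optimality is the output of a hypothetical run of `packProg`.
Termination of that program thus serves as an existence proof, even for the algorithm that outputs
only the orientation. -/
theorem Solved.optimal {s : Store} (hw : ∀ e ∈ G.edgeSet, 0 ≤ w e) (h : Solved L w r s) :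
    kd (outDigraph L s) w r = s.realVar 0 ∧ kRooted G w r = s.realVar 0 ∧
      IsGreatest (rootedValues G w r) (s.realVar 0) ∧
      IsGreatest (packingValues (outDigraph L s) w r) (s.realVar 0) := by
  refine optimal_of_packing hw (h.digraph ▸ h.rootedAcyclic) (h.digraph ▸ h.least) h.opt ?_
  obtain ⟨T, s', -, -, -, hp, hv, hD, h0⟩ := packProg_isPacking hw h
  rw [← hD, ← h0]
  exact ⟨_, _, _, hp, hv.symm⟩

theorem Solved.holdsOrientation {s : Store} (hw : ∀ e ∈ G.edgeSet, 0 ≤ w e)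
    (h : Solved L w r s) : HoldsOrientation L w r s := by
  obtain ⟨h1, h2, h3, -⟩ := h.optimal hw
  exact ⟨h.digraph ▸ h.rootedAcyclic, h2.symm, by rw [h2, h.digraph]; exact h.least,
    h1.trans h2.symm, by rwa [h2]⟩

theorem packProg_holdsRootedSolution {s : Store} (hw : ∀ e ∈ G.edgeSet, 0 ≤ w e)
    (h : Solved L w r s) :
    Runs packProg s fun T s' => T ≤ (m + m + 1) * (100 * (m + n) + 100) + 40 * m + 50 ∧
      HoldsRootedSolution L w r s' := by
  refine (packProg_isPacking hw h).mono ?_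
  rintro T s' - ⟨hT, h', hp, hv, -, -⟩
  obtain ⟨-, h2, -, h4⟩ := h'.optimal hw
  exact ⟨hT, h'.holdsOrientation hw, hp, hv.trans h2.symm, by rwa [h2]⟩

theorem HasInput.setRoot {s : Store} {r₀ : Fin n} (h : HasInput L w r₀ s) (r : Fin n) :
    HasInput L w r { s with natVar := Function.update s.natVar 2 r } :=
  ⟨by simp [h.size], by simp [h.edges], by simp, h.src, h.dst, h.weight⟩

/-- Determine a root (register `18`) of maximum value (real register `3`). -/
def rootProg : Prog :=
  .setReal 3 .zero⨾.setNat 18 (.lit 0)⨾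
  .forTo 20 0
    (.setNat 2 (.var 20)⨾solveProg⨾
    .branch (.realLe (.var 3) (.var 0)) (.setReal 3 (.var 0)⨾.setNat 18 (.var 20)) .skip)

theorem rootProg_runs {s : Store} (hG : IsTwoConnected G) (hw : ∀ e ∈ G.edgeSet, 0 ≤ w e)
    (h : HasInput L w r s) :
    Runs rootProg s fun T s' => T ≤ n * (700 * ((m - n + 1) * m) + 30) + 20 ∧
      (∃ r₀, HasInput L w r₀ s') ∧ ∃ r₁ : Fin n, s'.natVar 18 = r₁ ∧
        ∀ r', kRooted G w r' ≤ kRooted G w r₁ := by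
  have hn : 3 ≤ n := by simpa using hG.three_le
  simp only [rootProg, runs_seq, runs_setReal, runs_setNat]
  -- The root register is overwritten in every round, so the input survives only up to the choice of
  -- the root.
  refine (Runs.forTo (N := n) (fun i s' => (∃ r₀, HasInput L w r₀ s') ∧
      (i = 0 → s'.realVar 3 = 0) ∧
      (0 < i → ∃ r₁ : Fin n, s'.natVar 18 = r₁ ∧ s'.realVar 3 = kRooted G w r₁) ∧
      ∀ r' : Fin n, r'.val < i → kRooted G w r' ≤ s'.realVar 3) (700 * ((m - n + 1) * m) + 15)
      (by simp [h.size]) (by decide) (by decide) (by decide) ?_ ?_).mono ?_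
  · refine ⟨⟨r, ?_⟩, by simp, by simp, by simp⟩
    exact ⟨by simp [h.size], by simp [h.edges], by simp [h.root], h.src, h.dst, h.weight⟩
  · rintro i s₁ hi hfr hx ⟨⟨r₀, hin⟩, hz, hbest, hall⟩
    simp only [runs_seq, runs_setNat, NExp.eval, hx]
    refine (solveProg_runs hG hw (hin.setRoot ⟨i, hi⟩)).mono ?_
    rintro T s₂ hfr₂ ⟨hT, hs⟩
    have hopt := (hs.optimal hw).2.1
    have hnn := hs.value_nonneg hw
    have e3 : s₂.realVar 3 = s₁.realVar 3 := hfr₂.realVar 3 (by decide)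
    have e18 : s₂.natVar 18 = s₁.natVar 18 := by rw [hfr₂.natVar 18 (by decide)]; simp
    have e20 : s₂.natVar 20 = i := by rw [hfr₂.natVar 20 (by decide)]; simp [hx]
    have hin₂ := hs.input
    simp only [runs_branch, runs_seq, runs_setReal, runs_setNat, runs_skip, BExp.Holds, RExp.eval,
      NExp.eval, BExp.cost, RExp.cost, NExp.cost, e3, e20, ← hopt]
    refine ⟨fun hb => ⟨by omega, ⟨⟨i, hi⟩, ?_⟩, by simp, fun _ => ⟨⟨i, hi⟩, by simp, by simp⟩,
      fun r' hr' => ?_⟩, fun hb => ⟨by omega, ⟨⟨i, hi⟩, ?_⟩, by simp, fun _ => ?_,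
      fun r' hr' => ?_⟩⟩
    · exact ⟨by simp [hin₂.size], by simp [hin₂.edges], by simp [hin₂.root], hin₂.src, hin₂.dst,
        hin₂.weight⟩
    · simp only [Function.update_self]
      rcases Nat.lt_succ_iff_lt_or_eq.1 hr' with hr' | hr'
      · exact (hall r' hr').trans hb
      · obtain rfl : r' = ⟨i, hi⟩ := Fin.ext hr'
        exact le_rfl
    · exact ⟨by simp [hin₂.size], by simp [hin₂.edges], by simp [hin₂.root], hin₂.src, hin₂.dst,
        hin₂.weight⟩
    · have hi0 : 0 < i := by
        by_contra hi0
        rw [hz (by omega), hopt] at hb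
        exact hb hnn
      obtain ⟨r₁, h1, h2⟩ := hbest hi0
      exact ⟨r₁, by simp [e18, h1], by simp [h2]⟩
    · rcases Nat.lt_succ_iff_lt_or_eq.1 hr' with hr' | hr'
      · exact hall r' hr'
      · obtain rfl : r' = ⟨i, hi⟩ := Fin.ext hr'
        exact (not_le.1 hb).le
  · rintro T s' - ⟨hT, hin, -, hbest, hall⟩
    obtain ⟨r₁, h1, h2⟩ := hbest (by omega)
    refine ⟨?_, hin, r₁, h1, fun r' => h2 ▸ hall r' r'.2⟩
    have : n * (700 * ((m - n + 1) * m) + 15 + 9) ≤ n * (700 * ((m - n + 1) * m) + 30) :=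
      Nat.mul_le_mul_left _ (by omega)
    simp
    omega

/-- Solve BRP. -/
def broadcastProg : Prog := rootProg⨾.setNat 2 (.var 18)⨾solveProg⨾packProg

theorem broadcastProg_runs {s : Store} (hG : IsTwoConnected G) (hw : ∀ e ∈ G.edgeSet, 0 ≤ w e)
    (h : HasInput L w r s) :
    Runs broadcastProg s fun T s' => T ≤ n * (700 * ((m - n + 1) * m) + 30) + 20 + 2 +
      700 * ((m - n + 1) * m) + ((m + m + 1) * (100 * (m + n) + 100) + 40 * m + 50) ∧
      HoldsSolution L w s' := by
  refine Runs.seq ((rootProg_runs hG hw h).mono ?_)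
  rintro T₁ s₁ - ⟨hT₁, ⟨r₀, hin⟩, r₁, h18, hbest⟩
  simp only [runs_seq, runs_setNat, NExp.eval, h18]
  refine (solveProg_runs hG hw (hin.setRoot r₁)).mono ?_
  rintro T₂ s₂ - ⟨hT₂, hs₂⟩
  refine (packProg_holdsRootedSolution hw hs₂).mono ?_
  rintro T₃ s₃ hfr₃ ⟨hT₃, hs₃⟩
  refine ⟨?_, r₁, (hfr₃.natVar 2 (by decide)).trans hs₂.input.root, hs₃, ⟨r₁, rfl⟩, ?_⟩
  · simp only [NExp.cost]
    omega
  · rintro _ ⟨x, rfl⟩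
    exact hbest x

/-- A circuit of `G` leaves at least `m - n` edges. -/
theorem le_numChords (L : EdgeList G m) {u : Fin n} {c : G.Walk u u} (hc : c.IsCycle) :
    m - n ≤ numChords c := by
  classical
  have hlen : c.length ≤ n := by
    -- A cycle repeats only its base vertex, so the tail of its support lists distinct vertices, as
    -- many as the cycle has edges.
    have h1 := hc.support_nodup.length_le_card
    rw [Fintype.card_fin, List.length_tail, SimpleGraph.Walk.length_support] at h1
    omega
  have h1 : {e | e ∈ c.edges}.ncard ≤ n := by
    have : {e | e ∈ c.edges} = (c.edges.toFinset : Set (Sym2 (Fin n))) := by ext; simp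
    rw [this, Set.ncard_coe_finset]
    refine (List.toFinset_card_le _).trans ?_
    rwa [SimpleGraph.Walk.length_edges]
  have h2 := Set.le_ncard_sdiff {e | e ∈ c.edges} G.edgeSet
  rw [L.ncard_edgeSet] at h2
  unfold numChords
  omega

end Algorithms

end Broadcast

/-! ### Assembly: explicit step bounds and polynomials -/

theorem theorem3p10 :
    -- an optimal `r`-acyclic orientation in `O((k + 1) m)` steps
    (∃ (P : Broadcast.Prog) (C : ℕ), ∀ (n m : ℕ) (G : SimpleGraph (Fin n))
      (L : Broadcast.EdgeList G m) (w : Sym2 (Fin n) → ℝ) (r : Fin n),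
      Broadcast.IsTwoConnected G → Broadcast.IsOuterplanar G → (∀ e ∈ G.edgeSet, 0 ≤ w e) →
      ∃ (T : ℕ) (s : Broadcast.Store),
        Broadcast.Exec P (Broadcast.inputStore L w r) T s ∧
        Broadcast.HoldsOrientation L w r s ∧
        (∀ (u : Fin n) (c : G.Walk u u), Broadcast.IsOuterCircuit c →
          T ≤ C * ((Broadcast.numChords c + 1) * m)) ∧
        T ≤ C * ((m - n + 1) * m)) ∧
    -- rBRP in polynomial time
    (∃ (P : Broadcast.Prog) (p : Polynomial ℕ), ∀ (n m : ℕ) (G : SimpleGraph (Fin n))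
      (L : Broadcast.EdgeList G m) (w : Sym2 (Fin n) → ℝ) (r : Fin n),
      Broadcast.IsTwoConnected G → Broadcast.IsOuterplanar G → (∀ e ∈ G.edgeSet, 0 ≤ w e) →
      ∃ (T : ℕ) (s : Broadcast.Store),
        Broadcast.Exec P (Broadcast.inputStore L w r) T s ∧
        Broadcast.HoldsRootedSolution L w r s ∧
        T ≤ p.eval (n + m)) ∧
    -- BRP in polynomial time
    (∃ (P : Broadcast.Prog) (p : Polynomial ℕ), ∀ (n m : ℕ) (G : SimpleGraph (Fin n))
      (L : Broadcast.EdgeList G m) (w : Sym2 (Fin n) → ℝ),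
      Broadcast.IsTwoConnected G → Broadcast.IsOuterplanar G → (∀ e ∈ G.edgeSet, 0 ≤ w e) →
      ∃ (T : ℕ) (s : Broadcast.Store),
        Broadcast.Exec P (Broadcast.inputStore L w 0) T s ∧
        Broadcast.HoldsSolution L w s ∧
        T ≤ p.eval (n + m)) := by
  refine ⟨⟨Broadcast.solveProg, 700, ?_⟩, ⟨Broadcast.solveProg.seq Broadcast.packProg,
    1000 * (Polynomial.X + 1) ^ 2, ?_⟩, ⟨Broadcast.broadcastProg,
    2000 * (Polynomial.X + 1) ^ 3, ?_⟩⟩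
  · intro n m G L w r hG _ hw
    obtain ⟨T, s, he, hT, hs⟩ :=
      Broadcast.solveProg_runs hG hw (Broadcast.hasInput_inputStore L w r)
    refine ⟨T, s, he, hs.holdsOrientation hw, fun u c hc => hT.trans ?_, hT⟩
    -- The bound in terms of `m - n` implies the one in terms of chords for every outer circuit, of
    -- which only the cycle property is needed.
    exact Nat.mul_le_mul_left _ (Nat.mul_le_mul_right _
      (Nat.add_le_add_right (Broadcast.le_numChords L hc.1) 1))
  · intro n m G L w r hG _ hw
    obtain ⟨T, s, he, hT, hs⟩ :=
      Broadcast.solveProg_runs hG hw (Broadcast.hasInput_inputStore L w r)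
    obtain ⟨T', s', he', hT', hs'⟩ := Broadcast.packProg_holdsRootedSolution hw hs
    refine ⟨_, s', .seq he he', hs', ?_⟩
    have h1 : (m - n + 1) * m ≤ (m + 1) * m := Nat.mul_le_mul_right _ (by omega)
    simp only [Polynomial.eval_mul, Polynomial.eval_pow, Polynomial.eval_add, Polynomial.eval_X,
      Polynomial.eval_one, Polynomial.eval_ofNat]
    nlinarith
  · intro n m G L w hG _ hw
    have hn : 3 ≤ n := by simpa using hG.three_le
    obtain ⟨T, s, he, hT, hs⟩ := Broadcast.broadcastProg_runs hG hw
      (Broadcast.hasInput_inputStore L w (⟨0, by omega⟩ : Fin n))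
    refine ⟨T, s, he, hs, hT.trans ?_⟩
    have h1 : (m - n + 1) * m ≤ (n + m + 1) ^ 2 := by
      rw [sq]; exact Nat.mul_le_mul (by omega) (by omega)
    have h2 : n * (700 * ((m - n + 1) * m) + 30) ≤
        (n + m + 1) * (700 * (n + m + 1) ^ 2 + 30) :=
      Nat.mul_le_mul (by omega) (by omega)
    have h3 : (m + m + 1) * (100 * (m + n) + 100) ≤ 2 * (n + m + 1) * (100 * (n + m + 1)) :=
      Nat.mul_le_mul (by omega) (by omega)
    have h4 : (n + m + 1) ^ 2 ≤ (n + m + 1) ^ 3 := Nat.pow_le_pow_right (by omega) (by omega)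
    have h5 : n + m + 1 ≤ (n + m + 1) ^ 3 := Nat.le_self_pow (by omega) _
    simp only [Polynomial.eval_mul, Polynomial.eval_pow, Polynomial.eval_add, Polynomial.eval_X,
      Polynomial.eval_one, Polynomial.eval_ofNat]
    nlinarith
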